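/- **Setting.** $C_{l,Lip}(\mathbb R^n)$ is the space of $\varphi:\mathbb R^n\to\mathbb R$ with $|\varphi(x)-\varphi(y)|\le C(1+|x|^m+|y|^m)|x-y|$ for some $C>0$, $m\in\mathbb N$; $C_{b,Lip}(\mathbb R^n)$ is the space of bounded Lipschitz functions. A sub-linear expectation space $(\Omega,\mathscr H,\mathbb E)$ over a measurable space $(\Omega,\mathcal F)$ consists of a linear space $\mathscr H$ of real measurable functions with $\varphi(X_1,\dots,X_n)\in\mathscr H$ for all $X_i\in\mathscr H$, $\varphi\in C_{l,Lip}(\mathbb R^n)$, and a map $\mathbb E:\mathscr H\to[-\infty,\infty]$ that is monotone, satisfies $\mathbb E[c]=c$ for constants, $\mathbb E[\lambda X]=\lambda\mathbb E[X]$ for $\lambda\ge0$, and $\mathbb E[X+Y]\le\mathbb E[X]+\mathbb E[Y]$ whenever the right side is not of the form $\infty-\infty$. A capacity is a map $V:\mathcal F\to[0,1]$ that is nondecreasing with $V(\emptyset)=0$, $V(\Omega)=1$. Say that a set function $V$ has property (S) for $(\Omega,\mathscr H,\mathbb E)$ if $\mathbb E[f]\le V(A)\le\mathbb E[g]$ whenever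 $f,g\in\mathscr H$, $A\in\mathcal F$, $0\le f\le I_A\le g$. $X$ is tight if $V(|X|\ge c)\to0$ as $c\to\infty$. A vector $Y$ is independent to a vector $X$ under $\mathbb E$ if, for all $\varphi\in C_{l,Lip}$, with $\overline\varphi(x)=\mathbb E[|\varphi(x,Y)|]$ and $g(x)=\mathbb E[\varphi(x,Y)]$, one has $\mathbb E[\varphi(X,Y)]=\mathbb E[g(X)]$ whenever $\overline\varphi<\infty$ everywhere, $\overline\varphi(X),g(X)\in\mathscr H$ and $\mathbb E[|\overline\varphi(X)|]<\infty$. A sequence $(X_n)_{n\ge1}$ is independent if $X_{i+1}$ is independent to $(X_1,\dots,X_i)$ for each $i\ge1$. Put $\mathscr H_b=\{f\in\mathscr H: f\text{ bounded}\}$. A finitely additive linear expectation on $\mathscr H_b$ is a monotone linear $E:\mathscr H_b\to\mathbb R$ with $E[c]=c$. Further let $$\hat{\mathbb V}(A)=\inf\{\mathbb E[\xi]:I_A\le\xi\in\mathscr H\},\qquad \hat{\mathbb V}^*(A)=\inf\Big\{\sum_{n\ge1}\hat{\mathbb V}(A_n):A\subset\bigcup_nA_n,\ A_n\in\mathcal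 F\Big\},$$ $$\mathbb C^*(A)=\inf\Big\{\lim_{n\to\infty}\mathbb E\Big[\sum_{i=1}^ng_i\Big]:I_A\le\sum_{n\ge1}g_n,\ 0\le g_n\in\mathscr H\Big\}.$$ For a probability measure $P$, $P[\varphi]$ denotes $\int\varphi\,dP$. **Proposition.** Let $(\Omega,\mathscr H,\mathbb E)$ be a sub-linear expectation space with a capacity $V$ having property (S), and let $X_1,X_2,\dots\in\mathscr H$. Then there are a sub-linear expectation space $(\widetilde\Omega,\widetilde{\mathscr H},\widetilde{\mathbb E})$ with $\widetilde\Omega=\mathbb R^\infty$ (product topology) and $\widetilde X_1,\widetilde X_2,\dots\in\widetilde{\mathscr H}$ with the following properties; here $\widetilde{\mathscr H}$ is the set of all functions $x\mapsto\varphi(x_1,\dots,x_n)$ with $\varphi\in C_{l,Lip}(\mathbb R^n)$, $n\ge 1$, $\widetilde X_i(x)=x_i$, and $\widetilde{\mathcal F}=\sigma(\widetilde{\mathscr H})$ is the Borel $\sigma$-algebra of $\mathbb R^\infty$. Let $\widetilde{\mathscr P}$ be the set of all probability measures $P$ on $(\widetilde\Omega,\widetilde{\mathcal F})$ with $P[\varphi]\le\widetilde{\mathbb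 E}[\varphi]$ for all bounded $\varphi\in\widetilde{\mathscr H}$, and for $A\in\widetilde{\mathcal F}$ let $\widetilde V(A)=\sup_{P\in\widetilde{\mathscr P}}P(A)$ ($=0$ if $\widetilde{\mathscr P}=\emptyset$) and $\widetilde v(A)=1-\widetilde V(A^c)$. (a) $\widetilde{\mathbb E}[\varphi(\widetilde X_1,\dots,\widetilde X_n)]=\mathbb E[\varphi(X_1,\dots,X_n)]$ for all $n\ge1$ and $\varphi\in C_{l,Lip}(\mathbb R^n)$. In particular, if $(X_n)$ is independent under $\mathbb E$, then $(\widetilde X_n)$ is independent under $\widetilde{\mathbb E}$. (b) $\widetilde V$ takes values in $[0,1]$, is nondecreasing and countably sub-additive on $\widetilde{\mathcal F}$, and $\widetilde V\le\widetilde{\mathbb C}^*\le\widetilde{\mathbb V}^*\le\widetilde{\mathbb V}$ on $\widetilde{\mathcal F}$, where $\widetilde{\mathbb V},\widetilde{\mathbb V}^*,\widetilde{\mathbb C}^*$ are $\hat{\mathbb V},\hat{\mathbb V}^*,\mathbb C^*$ formed from $(\widetilde\Omega,\widetilde{\mathscr H},\widetilde{\mathbb E})$. (c) If each $X_n$ is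 tight, then $\widetilde{\mathscr P}$ is weakly compact, $\widetilde{\mathbb E}[\varphi]=\sup_{P\in\widetilde{\mathscr P}}P[\varphi]$ for all bounded $\varphi\in\widetilde{\mathscr H}$, and $\widetilde V$ is a countably sub-additive capacity with property (S) for $(\widetilde\Omega,\widetilde{\mathscr H},\widetilde{\mathbb E})$. (d) Suppose that $(X_n)$ is independent under $\mathbb E$ and each $X_n$ is tight. Let $0\le n_0<n_1<n_2<\cdots$ be integers, $\xi_k=(X_{n_{k-1}+1},\dots,X_{n_k})$ and $\widetilde\xi_k=(\widetilde X_{n_{k-1}+1},\dots,\widetilde X_{n_k})$ for $k\ge1$, and let $E_k$ $(k\ge1)$ be finitely additive linear expectations on $\mathscr H_b$ with $E_k\le\mathbb E$ on $\mathscr H_b$. Then there is a probability measure $Q$ on $\sigma(\widetilde X_1,\widetilde X_2,\dots)=\mathscr B(\mathbb R^\infty)$ such that $\widetilde\xi_1,\widetilde\xi_2,\dots$ are independent under $Q$, $$Q[\varphi(\widetilde\xi_k)]=E_k[\varphi(\xi_k)]\quad\text{for all }k\ge1,\ \varphi\in C_{b,Lip}(\mathbb R^{n_k-n_{k-1}}),$$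 $$Q[\varphi(\widetilde X_1,\dots,\widetilde X_n)]\le\mathbb E[\varphi(X_1,\dots,X_n)]\quad\text{for all }n\ge1,\ \varphi\in C_{b,Lip}(\mathbb R^n),$$ $$\widetilde v\big((\widetilde X_1,\widetilde X_2,\dots)\in B\big)\le Q\big((\widetilde X_1,\widetilde X_2,\dots)\in B\big)\le\widetilde V\big((\widetilde X_1,\widetilde X_2,\dots)\in B\big)\quad\text{for all }B\in\mathscr B(\mathbb R^\infty).$$ -/

import Mathlib

open MeasureTheory ProbabilityTheory Filter Topology
open scoped ENNReal

namespace SubLin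

/-- The class `C_{l,Lip}`: local Lipschitz functions with polynomially growing Lipschitz constant.
On a finite-dimensional space it does not depend on the choice of the norm. -/
def LocLip {F : Type*} [NormedAddCommGroup F] (φ : F → ℝ) : Prop :=
  ∃ C : ℝ, 0 < C ∧ ∃ m : ℕ, ∀ x y : F,
    |φ x - φ y| ≤ C * (1 + ‖x‖ ^ m + ‖y‖ ^ m) * ‖x - y‖

/-- The class `C_{b,Lip}`: bounded Lipschitz functions. -/
def BddLip {F : Type*} [NormedAddCommGroup F] (φ : F → ℝ) : Prop :=
  (∃ M : ℝ, ∀ x, |φ x| ≤ M) ∧ ∃ K : NNReal, LipschitzWith K φ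

/-- A sub-linear expectation space `(Ω, H, E)` over a measurable space `Ω`. The functional `E` takes
values in `[-∞, ∞]`; only its values on `H` are meaningful. -/
structure SublinearExpectationSpace (Ω : Type*) [MeasurableSpace Ω] where
  /-- the linear space of random variables -/
  H : Submodule ℝ (Ω → ℝ)
  measurable_of_mem : ∀ X ∈ H, Measurable X
  comp_mem : ∀ (n : ℕ) (X : Fin n → Ω → ℝ), (∀ i, X i ∈ H) →
    ∀ φ : (Fin n → ℝ) → ℝ, LocLip φ → (fun ω => φ (fun i => X i ω)) ∈ H
  /-- the sub-linear expectation -/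
  E : (Ω → ℝ) → EReal
  mono : ∀ X ∈ H, ∀ Y ∈ H, (∀ ω, Y ω ≤ X ω) → E Y ≤ E X
  const : ∀ c : ℝ, E (fun _ => c) = (c : EReal)
  subadd : ∀ X ∈ H, ∀ Y ∈ H, ¬ (E X = ⊤ ∧ E Y = ⊥) → ¬ (E X = ⊥ ∧ E Y = ⊤) →
    E (X + Y) ≤ E X + E Y
  pos_homog : ∀ X ∈ H, ∀ c : ℝ, 0 ≤ c → E (c • X) = (c : EReal) * E X

/-- A capacity on the measurable sets; monotonicity and `V Ω = 1` force its values into `[0, 1]`. -/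
structure IsCapacity {Ω : Type*} [MeasurableSpace Ω] (V : Set Ω → ℝ≥0∞) : Prop where
  empty : V ∅ = 0
  univ : V Set.univ = 1
  mono : ∀ A B : Set Ω, MeasurableSet A → MeasurableSet B → A ⊆ B → V A ≤ V B

/-- Countable sub-additivity on the measurable sets. -/
def CountablySubadditive {Ω : Type*} [MeasurableSpace Ω] (V : Set Ω → ℝ≥0∞) : Prop :=
  ∀ A : ℕ → Set Ω, (∀ i, MeasurableSet (A i)) → V (⋃ i, A i) ≤ ∑' i, V (A i)

/-- `X` is tight under `V`: `V(|X| ≥ c) → 0` as `c → ∞`. -/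
def Tight {Ω : Type*} (V : Set Ω → ℝ≥0∞) (X : Ω → ℝ) : Prop :=
  Tendsto (fun c : ℝ => V {ω | c ≤ |X ω|}) atTop (𝓝 0)

/-- `E` is a (finitely additive) linear expectation on the set `L` of real functions. -/
structure IsLinearExpectationOn {Ω : Type*} (L : Set (Ω → ℝ)) (E : (Ω → ℝ) → ℝ) : Prop where
  mono : ∀ f ∈ L, ∀ g ∈ L, (∀ ω, g ω ≤ f ω) → E g ≤ E f
  const : ∀ c : ℝ, E (fun _ => c) = c
  add : ∀ f ∈ L, ∀ g ∈ L, E (f + g) = E f + E g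
  smul : ∀ f ∈ L, ∀ c : ℝ, E (c • f) = c * E f

/-- The functions `x ↦ φ(x₁, …, x_n)` on `ℝ^∞`, with `φ ∈ C_{l,Lip}(ℝⁿ)`. -/
def cylinderFunctions : Set ((ℕ → ℝ) → ℝ) :=
  {f | ∃ (n : ℕ) (φ : (Fin n → ℝ) → ℝ), LocLip φ ∧ f = fun x => φ (fun i => x i)}

namespace SublinearExpectationSpace

variable {Ω : Type*} [MeasurableSpace Ω] (S : SublinearExpectationSpace Ω)

/-- `H_b`, the bounded elements of `H`. -/
def Hb : Set (Ω → ℝ) := {f | f ∈ S.H ∧ ∃ M : ℝ, ∀ ω, |f ω| ≤ M}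

/-- The σ-algebra `σ(H)`. -/
@[reducible] def sigmaH : MeasurableSpace Ω := ⨆ f ∈ S.H, MeasurableSpace.comap f (borel ℝ)

/-- The property `E[f] ≤ V(A) ≤ E[g]` whenever `0 ≤ f ≤ I_A ≤ g`, with `f, g ∈ H`. -/
def Sandwich (V : Set Ω → ℝ≥0∞) : Prop :=
  ∀ A : Set Ω, MeasurableSet A → ∀ f ∈ S.H, ∀ g ∈ S.H,
    (∀ ω, 0 ≤ f ω) → (∀ ω, f ω ≤ A.indicator (fun _ => (1 : ℝ)) ω) →
    (∀ ω, A.indicator (fun _ => (1 : ℝ)) ω ≤ g ω) →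
    S.E f ≤ (V A : EReal) ∧ (V A : EReal) ≤ S.E g

/-- The random vector `Y` is independent to the random vector `X` under `E`: for every test
function `φ`, with `φ̄(x) = E[|φ(x, Y)|]` and `g(x) = E[φ(x, Y)]`, one has `E[φ(X, Y)] = E[g(X)]`
whenever `φ̄(x) < ∞` for all `x` and `E[|φ̄(X)|] < ∞`. Since `E` is defined on `H` only, `φ̄(X)` and
`g(X)` have to belong to `H` for these conditions and this equation to have a meaning. Where
`φ̄ < ∞`, both `φ̄` and `g` are real-valued. -/
def IndepTo {m n : ℕ} (Y : Fin n → Ω → ℝ) (X : Fin m → Ω → ℝ) : Prop :=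
  ∀ φ : (Fin m → ℝ) × (Fin n → ℝ) → ℝ, LocLip φ →
    ∀ φbar g : (Fin m → ℝ) → EReal,
      (∀ x, φbar x = S.E (fun ω => |φ (x, fun j => Y j ω)|)) →
      (∀ x, g x = S.E (fun ω => φ (x, fun j => Y j ω))) →
      (∀ x, φbar x < ⊤) →
      (fun ω => (φbar (fun i => X i ω)).toReal) ∈ S.H →
      (fun ω => (g (fun i => X i ω)).toReal) ∈ S.H →
      S.E (fun ω => |(φbar (fun i => X i ω)).toReal|) < ⊤ →
      S.E (fun ω => φ (fun i => X i ω, fun j => Y j ω)) =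
        S.E (fun ω => (g (fun i => X i ω)).toReal)

/-- Independence of a sequence: each variable but the first is independent to the vector of its
predecessors. -/
def IndepSeq (X : ℕ → Ω → ℝ) : Prop :=
  ∀ i : ℕ, 1 ≤ i → S.IndepTo (fun _ : Fin 1 => X i) (fun j : Fin i => X j)

/-- The upper capacity `𝕍̂(A) = inf {E[ξ] : I_A ≤ ξ, ξ ∈ H}` (each such `E[ξ]` is nonnegative). -/
noncomputable def upCap (A : Set Ω) : ℝ≥0∞ :=
  ⨅ (ξ : Ω → ℝ) (_ : ξ ∈ S.H) (_ : ∀ ω, A.indicator (fun _ => (1 : ℝ)) ω ≤ ξ ω),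
    (S.E ξ).toENNReal

/-- The countably sub-additive extension `𝕍̂*(A) = inf {∑ 𝕍̂(Aₙ) : A ⊆ ⋃ Aₙ}`. -/
noncomputable def upCapStar (A : Set Ω) : ℝ≥0∞ :=
  ⨅ (B : ℕ → Set Ω) (_ : ∀ i, MeasurableSet (B i)) (_ : A ⊆ ⋃ i, B i), ∑' i, S.upCap (B i)

/-- `ℂ*(A) = inf {lim_n E[g₁ + ⋯ + gₙ] : I_A ≤ ∑ gₙ, 0 ≤ gₙ ∈ H}`; the limit is that of a
nondecreasing sequence of nonnegative numbers, and the series may diverge to `∞`. -/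
noncomputable def cStar (A : Set Ω) : ℝ≥0∞ :=
  ⨅ (g : ℕ → Ω → ℝ) (_ : ∀ i, g i ∈ S.H) (_ : ∀ i ω, 0 ≤ g i ω)
    (_ : ∀ ω, A.indicator (fun _ => (1 : ℝ≥0∞)) ω ≤ ∑' i, ENNReal.ofReal (g i ω)),
    ⨆ n : ℕ, (S.E (∑ i ∈ Finset.range n, g i)).toENNReal

/-- The family of all probability measures `P` with `P[φ] ≤ E[φ]` for all bounded `φ ∈ H`. -/
def dominated : Set (ProbabilityMeasure Ω) :=
  {P | ∀ φ ∈ S.Hb, ((∫ ω, φ ω ∂(P : Measure Ω) : ℝ) : EReal) ≤ S.E φ}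

/-- The upper probability `A ↦ sup P(A)` over the dominated probability measures (zero if there are
none). -/
noncomputable def upperProb (A : Set Ω) : ℝ≥0∞ :=
  ⨆ P ∈ S.dominated, (P : Measure Ω) A

/-- The conjugate lower probability; no truncation occurs in the difference. -/
noncomputable def lowerProb (A : Set Ω) : ℝ≥0∞ := 1 - S.upperProb Aᶜ

end SublinearExpectationSpace

end SubLin

namespace SubLin

/-! ### Locally Lipschitz maps of polynomial growth -/

section PolyLip

variable {F G K : Type*} [NormedAddCommGroup F] [NormedAddCommGroup G] [NormedAddCommGroup K]

/-- Locally Lipschitz maps whose Lipschitz constant has polynomial growth, in a form which is stable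
under composition. -/
def PolyLip (φ : F → G) : Prop :=
  ∃ C : ℝ, 0 ≤ C ∧ ∃ k : ℕ, ∀ x y, ‖φ x - φ y‖ ≤ C * (1 + ‖x‖ + ‖y‖) ^ k * ‖x - y‖

theorem LocLip.polyLip {φ : F → ℝ} (h : LocLip φ) : PolyLip φ := by
  obtain ⟨C, hC, m, h⟩ := h
  refine ⟨C * 3, by positivity, m, fun x y => (h x y).trans ?_⟩
  have hx := norm_nonneg x
  have hy := norm_nonneg y
  have h1 : (1 : ℝ) ≤ (1 + ‖x‖ + ‖y‖) ^ m := one_le_pow₀ (by linarith)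
  have h2 : ‖x‖ ^ m ≤ (1 + ‖x‖ + ‖y‖) ^ m := by gcongr; linarith
  have h3 : ‖y‖ ^ m ≤ (1 + ‖x‖ + ‖y‖) ^ m := by gcongr; linarith
  rw [mul_assoc C 3]
  gcongr
  linarith

theorem PolyLip.locLip {φ : F → ℝ} (h : PolyLip φ) : LocLip φ := by
  obtain ⟨C, hC, m, h⟩ := h
  refine ⟨C * 3 ^ m + 1, by positivity, m, fun x y => (h x y).trans ?_⟩
  have hx := norm_nonneg x
  have hy := norm_nonneg y
  have key : (1 + ‖x‖ + ‖y‖) ^ m ≤ 3 ^ m * (1 + ‖x‖ ^ m + ‖y‖ ^ m) := by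
    have h0 : 1 + ‖x‖ + ‖y‖ ≤ 3 * max 1 (max ‖x‖ ‖y‖) := by
      have := le_max_left 1 (max ‖x‖ ‖y‖)
      have h2 := (le_max_left ‖x‖ ‖y‖).trans (le_max_right 1 (max ‖x‖ ‖y‖))
      have h3 := (le_max_right ‖x‖ ‖y‖).trans (le_max_right 1 (max ‖x‖ ‖y‖))
      linarith
    calc (1 + ‖x‖ + ‖y‖) ^ m ≤ (3 * max 1 (max ‖x‖ ‖y‖)) ^ m := by gcongr
      _ = 3 ^ m * (max 1 (max ‖x‖ ‖y‖)) ^ m := mul_pow _ _ _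
      _ ≤ _ := by
        gcongr
        have hxm : 0 ≤ ‖x‖ ^ m := by positivity
        have hym : 0 ≤ ‖y‖ ^ m := by positivity
        rcases max_choice 1 (max ‖x‖ ‖y‖) with h | h <;> rw [h]
        · rw [one_pow]; linarith
        · rcases max_choice ‖x‖ ‖y‖ with h | h <;> rw [h] <;> linarith
  refine mul_le_mul_of_nonneg_right ?_ (norm_nonneg (x - y))
  calc C * (1 + ‖x‖ + ‖y‖) ^ m ≤ C * (3 ^ m * (1 + ‖x‖ ^ m + ‖y‖ ^ m)) := by gcongr
    _ ≤ _ := by nlinarith [pow_nonneg hx m, pow_nonneg hy m]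

theorem polyLip_of_lipschitz {φ : F → G} {C : ℝ} (h0 : 0 ≤ C)
    (h : ∀ x y, ‖φ x - φ y‖ ≤ C * ‖x - y‖) : PolyLip φ :=
  ⟨C, h0, 0, by simpa using h⟩

theorem PolyLip.comp {φ : G → K} {ψ : F → G} (hφ : PolyLip φ) (hψ : PolyLip ψ) :
    PolyLip (φ ∘ ψ) := by
  obtain ⟨C, hC, k, hφ⟩ := hφ
  obtain ⟨D, hD, l, hψ⟩ := hψ
  refine ⟨C * (1 + 2 * (‖ψ 0‖ + D)) ^ k * D, by positivity, (l + 1) * k + l, fun x y => ?_⟩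
  set W := 1 + ‖x‖ + ‖y‖ with hW
  have hx := norm_nonneg x
  have hy := norm_nonneg y
  have hW1 : 1 ≤ W := by linarith
  have bound : ∀ z : F, ‖z‖ + 1 ≤ W → ‖ψ z‖ ≤ (‖ψ 0‖ + D) * W ^ (l + 1) := by
    intro z hz
    have h1 : ‖ψ z‖ ≤ ‖ψ 0‖ + ‖ψ z - ψ 0‖ := by
      have := norm_add_le (ψ 0) (ψ z - ψ 0)
      simpa using this
    have h2 : ‖ψ z - ψ 0‖ ≤ D * W ^ l * W := by
      refine (hψ z 0).trans ?_
      simp only [norm_zero, add_zero, sub_zero]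
      gcongr <;> linarith
    have h3 : ‖ψ 0‖ * 1 ≤ ‖ψ 0‖ * W ^ (l + 1) := by
      gcongr
      exact one_le_pow₀ hW1
    calc _ ≤ _ := h1
      _ ≤ ‖ψ 0‖ * W ^ (l + 1) + D * W ^ l * W := by linarith
      _ = _ := by ring
  have hW2 : 1 ≤ W ^ (l + 1) := one_le_pow₀ hW1
  calc ‖φ (ψ x) - φ (ψ y)‖ ≤ C * (1 + ‖ψ x‖ + ‖ψ y‖) ^ k * ‖ψ x - ψ y‖ := hφ _ _
    _ ≤ C * ((1 + 2 * (‖ψ 0‖ + D)) * W ^ (l + 1)) ^ k * (D * W ^ l * ‖x - y‖) := by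
      gcongr
      · have := bound x (by linarith)
        have := bound y (by linarith)
        linarith
      · exact hψ x y
    _ = _ := by rw [mul_pow, ← pow_mul]; ring

theorem PolyLip.pi {ι : Type*} [Fintype ι] {ψ : ι → F → G} (h : ∀ i, PolyLip (ψ i)) :
    PolyLip (fun x i => ψ i x) := by
  choose C hC k h using h
  refine ⟨∑ i, C i, Finset.sum_nonneg fun i _ => hC i, ∑ i, k i, fun x y => ?_⟩
  have hW1 : 1 ≤ 1 + ‖x‖ + ‖y‖ := by linarith [norm_nonneg x, norm_nonneg y]
  refine (pi_norm_le_iff_of_nonneg ?_).2 fun i => (h i x y).trans ?_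
  · have := Finset.sum_nonneg fun i (_ : i ∈ Finset.univ) => hC i
    positivity
  · gcongr
    · exact Finset.sum_nonneg fun i _ => hC i
    · exact Finset.single_le_sum (fun i _ => hC i) (Finset.mem_univ i)
    · exact Finset.single_le_sum (fun i _ => Nat.zero_le (k i)) (Finset.mem_univ i)

theorem polyLip_apply {ι : Type*} [Fintype ι] (i : ι) : PolyLip (fun x : ι → ℝ => x i) :=
  polyLip_of_lipschitz zero_le_one fun x y => by simpa using norm_le_pi_norm (x - y) i

theorem PolyLip.continuous {φ : F → G} (h : PolyLip φ) : Continuous φ := by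
  obtain ⟨C, hC, k, h⟩ := h
  rw [continuous_iff_continuousAt]
  intro x
  rw [ContinuousAt, tendsto_iff_norm_sub_tendsto_zero]
  have : Tendsto (fun y => C * (1 + ‖y‖ + ‖x‖) ^ k * ‖y - x‖) (𝓝 x)
      (𝓝 (C * (1 + ‖x‖ + ‖x‖) ^ k * ‖x - x‖)) :=
    Continuous.tendsto (by fun_prop) x
  simp only [sub_self, norm_zero, mul_zero] at this
  exact squeeze_zero (fun _ => norm_nonneg _) (fun y => h y x) this

end PolyLip

theorem polyLip_add : PolyLip (fun v : Fin 2 → ℝ => v 0 + v 1) :=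
  polyLip_of_lipschitz (C := 2) (by norm_num) fun x y => by
    have h0 : |x 0 - y 0| ≤ ‖x - y‖ := norm_le_pi_norm (x - y) 0
    have h1 : |x 1 - y 1| ≤ ‖x - y‖ := norm_le_pi_norm (x - y) 1
    rw [Real.norm_eq_abs, show x 0 + x 1 - (y 0 + y 1) = (x 0 - y 0) + (x 1 - y 1) by ring]
    exact (abs_add_le _ _).trans (by linarith)

theorem polyLip_of_lipschitz_one {φ : ℝ → ℝ} {C : ℝ} (h : ∀ s t, |φ s - φ t| ≤ C * |s - t|) :
    PolyLip φ :=
  polyLip_of_lipschitz (C := |C|) (abs_nonneg _) fun x y =>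
    (h x y).trans (mul_le_mul_of_nonneg_right (le_abs_self C) (abs_nonneg _))

/-! ### Cylinder functions -/

theorem comp_mem_cylinderFunctions (n : ℕ) (f : Fin n → (ℕ → ℝ) → ℝ)
    (hf : ∀ i, f i ∈ cylinderFunctions) (φ : (Fin n → ℝ) → ℝ) (hφ : LocLip φ) :
    (fun x => φ fun i => f i x) ∈ cylinderFunctions := by
  choose d ψ hψ hf using hf
  have hd : ∀ i, d i ≤ ∑ i, d i := fun i =>
    Finset.single_le_sum (fun i _ => Nat.zero_le (d i)) (Finset.mem_univ i)
  refine ⟨∑ i, d i, fun v => φ fun i => ψ i fun j => v (Fin.castLE (hd i) j), ?_, ?_⟩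
  · exact (hφ.polyLip.comp (PolyLip.pi fun i =>
      (hψ i).polyLip.comp (PolyLip.pi fun j => polyLip_apply _))).locLip
  · ext x
    simp [hf]

theorem coord_mem_cylinderFunctions (i : ℕ) : (fun x : ℕ → ℝ => x i) ∈ cylinderFunctions :=
  ⟨i + 1, fun v => v (Fin.last i), (polyLip_apply _).locLip, by simp⟩

theorem const_mem_cylinderFunctions (c : ℝ) :
    (fun _ : ℕ → ℝ => c) ∈ cylinderFunctions :=
  ⟨0, fun _ => c, (polyLip_of_lipschitz le_rfl (C := 0) (by simp)).locLip, rfl⟩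

theorem continuous_of_mem_cylinderFunctions {f : (ℕ → ℝ) → ℝ} (hf : f ∈ cylinderFunctions) :
    Continuous f := by
  obtain ⟨n, φ, hφ, rfl⟩ := hf
  exact hφ.polyLip.continuous.comp (by fun_prop)

theorem comp_one_mem_cylinderFunctions {f : (ℕ → ℝ) → ℝ} (hf : f ∈ cylinderFunctions)
    {φ : ℝ → ℝ} (hφ : PolyLip φ) : (fun x => φ (f x)) ∈ cylinderFunctions :=
  comp_mem_cylinderFunctions 1 (fun _ => f) (fun _ => hf) (fun v => φ (v 0))
    (hφ.comp (polyLip_apply 0)).locLip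

/-- The linear space of cylinder functions. -/
def cylinderSubmodule : Submodule ℝ ((ℕ → ℝ) → ℝ) where
  carrier := cylinderFunctions
  add_mem' {f g} hf hg := comp_mem_cylinderFunctions 2 ![f, g]
    (by intro i; fin_cases i <;> assumption) _ polyLip_add.locLip
  zero_mem' := const_mem_cylinderFunctions 0
  smul_mem' c f hf := comp_one_mem_cylinderFunctions hf (φ := fun t => c * t)
    (polyLip_of_lipschitz_one (C := |c|) fun s t => by rw [← mul_sub, abs_mul])

namespace SublinearExpectationSpace

variable {Ω : Type*} [MeasurableSpace Ω] (S : SublinearExpectationSpace Ω)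

theorem comp_sequence_mem {X : ℕ → Ω → ℝ} (hX : ∀ i, X i ∈ S.H) {f : (ℕ → ℝ) → ℝ}
    (hf : f ∈ cylinderFunctions) : (fun ω => f fun i => X i ω) ∈ S.H := by
  obtain ⟨n, φ, hφ, rfl⟩ := hf
  exact S.comp_mem n (fun i => X i) (fun i => hX i) φ hφ

/-- The sub-linear expectation on `ℝ^∞` induced by a sequence of random variables. -/
def ofSequence (X : ℕ → Ω → ℝ) (hX : ∀ i, X i ∈ S.H) :
    SublinearExpectationSpace (ℕ → ℝ) where
  H := cylinderSubmodule
  measurable_of_mem _ hf := (continuous_of_mem_cylinderFunctions hf).measurable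
  comp_mem := comp_mem_cylinderFunctions
  E f := S.E fun ω => f fun i => X i ω
  mono _ hf _ hg h := S.mono _ (S.comp_sequence_mem hX hf) _ (S.comp_sequence_mem hX hg)
    fun _ => h _
  const c := S.const c
  subadd _ hf _ hg h h' := S.subadd _ (S.comp_sequence_mem hX hf) _ (S.comp_sequence_mem hX hg) h h'
  pos_homog _ hf c hc := S.pos_homog _ (S.comp_sequence_mem hX hf) c hc

theorem indepSeq_ofSequence {X : ℕ → Ω → ℝ} (hX : ∀ i, X i ∈ S.H) (h : S.IndepSeq X) :
    (S.ofSequence X hX).IndepSeq fun i x => x i := by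
  intro i hi φ hφ φbar g h1 h2 h3 h4 h5 h6
  exact h i hi φ hφ φbar g h1 h2 h3 (S.comp_sequence_mem hX h4) (S.comp_sequence_mem hX h5) h6

theorem sigmaH_eq_borel (T : SublinearExpectationSpace (ℕ → ℝ))
    (hT : (T.H : Set ((ℕ → ℝ) → ℝ)) = cylinderFunctions) : T.sigmaH = borel (ℕ → ℝ) := by
  have hT' : ∀ f, f ∈ T.H ↔ f ∈ cylinderFunctions := fun f => by rw [← hT]; rfl
  apply le_antisymm
  · refine iSup₂_le fun f hf => ?_
    have := (continuous_of_mem_cylinderFunctions ((hT' f).1 hf)).borel_measurable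
    exact this.comap_le
  · rw [← BorelSpace.measurable_eq (α := ℕ → ℝ)]
    refine iSup_le fun i => ?_
    refine le_trans ?_ (le_iSup₂ (f := fun f (_ : f ∈ T.H) =>
      MeasurableSpace.comap f (borel ℝ)) (fun x => x i) ((hT' _).2 (coord_mem_cylinderFunctions i)))
    rw [BorelSpace.measurable_eq (α := ℝ)]

end SublinearExpectationSpace

end SubLin

namespace SubLin

namespace SublinearExpectationSpace

variable {Ω : Type*} [MeasurableSpace Ω] (S : SublinearExpectationSpace Ω)

/-! ### Elementary properties of sub-linear expectations -/

theorem const_mem (c : ℝ) : (fun _ => c) ∈ S.H :=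
  S.comp_mem 0 (fun i => i.elim0) (fun i => i.elim0) (fun _ => c)
    (polyLip_of_lipschitz le_rfl (C := 0) (by simp)).locLip

theorem comp_one_mem {f : Ω → ℝ} (hf : f ∈ S.H) {φ : ℝ → ℝ} (hφ : PolyLip φ) :
    (fun ω => φ (f ω)) ∈ S.H :=
  S.comp_mem 1 (fun _ => f) (fun _ => hf) (fun v => φ (v 0))
    (hφ.comp (polyLip_apply 0)).locLip

theorem min_const_mem {f : Ω → ℝ} (hf : f ∈ S.H) (c : ℝ) : (fun ω => min (f ω) c) ∈ S.H :=
  S.comp_one_mem hf (φ := fun t => min t c) (polyLip_of_lipschitz_one (C := 1) fun s t => by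
    simpa using abs_min_sub_min_le_max s c t c)

theorem E_nonneg {f : Ω → ℝ} (hf : f ∈ S.H) (h : ∀ ω, 0 ≤ f ω) : 0 ≤ S.E f := by
  simpa [S.const 0] using S.mono f hf _ (S.const_mem 0) h

theorem E_le_of_le {f : Ω → ℝ} (hf : f ∈ S.H) {c : ℝ} (h : ∀ ω, f ω ≤ c) : S.E f ≤ c := by
  simpa [S.const c] using S.mono _ (S.const_mem c) f hf h

theorem le_E_of_le {f : Ω → ℝ} (hf : f ∈ S.H) {c : ℝ} (h : ∀ ω, c ≤ f ω) : c ≤ S.E f := by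
  simpa [S.const c] using S.mono f hf _ (S.const_mem c) h

/-- The linear space of bounded random variables. -/
def boundedSubmodule : Submodule ℝ (Ω → ℝ) where
  carrier := S.Hb
  add_mem' := by
    rintro f g ⟨hf, M, hM⟩ ⟨hg, N, hN⟩
    exact ⟨S.H.add_mem hf hg, M + N, fun ω =>
      (abs_add_le _ _).trans (add_le_add (hM ω) (hN ω))⟩
  zero_mem' := ⟨S.H.zero_mem, 0, fun ω => by simp⟩
  smul_mem' := by
    rintro c f ⟨hf, M, hM⟩
    exact ⟨S.H.smul_mem c hf, |c| * M, fun ω => by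
      simpa [abs_mul] using mul_le_mul_of_nonneg_left (hM ω) (abs_nonneg c)⟩

theorem const_mem_Hb (c : ℝ) : (fun _ => c) ∈ S.Hb := ⟨S.const_mem c, |c|, fun _ => le_rfl⟩

/-- The real-valued version of the sub-linear expectation, for bounded random variables. -/
noncomputable def e (f : Ω → ℝ) : ℝ := (S.E f).toReal

theorem coe_e {f : Ω → ℝ} (hf : f ∈ S.Hb) : ((S.e f : ℝ) : EReal) = S.E f := by
  obtain ⟨hf, M, hM⟩ := hf
  refine EReal.coe_toReal ?_ ?_
  · exact ((S.E_le_of_le hf fun ω => (abs_le.1 (hM ω)).2).trans_lt (EReal.coe_lt_top M)).ne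
  · exact ((EReal.bot_lt_coe (-M)).trans_le (S.le_E_of_le hf fun ω => (abs_le.1 (hM ω)).1)).ne'

theorem e_const (c : ℝ) : S.e (fun _ => c) = c := by simp [e, S.const]

theorem e_mono {f g : Ω → ℝ} (hf : f ∈ S.Hb) (hg : g ∈ S.Hb) (h : ∀ ω, f ω ≤ g ω) :
    S.e f ≤ S.e g := by
  rw [← EReal.coe_le_coe_iff, S.coe_e hf, S.coe_e hg]
  exact S.mono g hg.1 f hf.1 h

theorem e_add_le {f g : Ω → ℝ} (hf : f ∈ S.Hb) (hg : g ∈ S.Hb) :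
    S.e (f + g) ≤ S.e f + S.e g := by
  rw [← EReal.coe_le_coe_iff, EReal.coe_add, S.coe_e hf, S.coe_e hg,
    S.coe_e (S.boundedSubmodule.add_mem hf hg)]
  refine S.subadd f hf.1 g hg.1 ?_ ?_
  · rw [← S.coe_e hf]
    simp
  · rw [← S.coe_e hg]
    simp

theorem e_smul {f : Ω → ℝ} (hf : f ∈ S.Hb) {c : ℝ} (hc : 0 ≤ c) : S.e (c • f) = c * S.e f := by
  rw [← EReal.coe_eq_coe_iff, EReal.coe_mul, S.coe_e hf,
    S.coe_e (S.boundedSubmodule.smul_mem c hf)]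
  exact S.pos_homog f hf.1 c hc

theorem e_zero : S.e 0 = 0 := S.e_const 0

theorem e_sum_le {ι : Type*} (s : Finset ι) {f : ι → Ω → ℝ} (hf : ∀ i ∈ s, f i ∈ S.Hb) :
    S.e (∑ i ∈ s, f i) ≤ ∑ i ∈ s, S.e (f i) := by
  classical
  induction s using Finset.induction_on with
  | empty => simp [S.e_zero]
  | insert a s ha ih =>
    rw [Finset.sum_insert ha, Finset.sum_insert ha]
    have h1 := hf a (Finset.mem_insert_self _ _)
    have h2 : ∀ i ∈ s, f i ∈ S.Hb := fun i hi => hf i (Finset.mem_insert_of_mem hi)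
    exact (S.e_add_le h1 (S.boundedSubmodule.sum_mem h2)).trans (by linarith [ih h2])

theorem e_sub_le {f g r : Ω → ℝ} (hf : f ∈ S.Hb) (hg : g ∈ S.Hb) (hr : r ∈ S.Hb)
    (h : ∀ ω, f ω ≤ g ω + r ω) : S.e f ≤ S.e g + S.e r :=
  (S.e_mono hf (S.boundedSubmodule.add_mem hg hr) h).trans (S.e_add_le hg hr)

theorem abs_e_sub_le {f g : Ω → ℝ} (hf : f ∈ S.Hb) (hg : g ∈ S.Hb) {c : ℝ}
    (h : ∀ ω, |f ω - g ω| ≤ c) : |S.e f - S.e g| ≤ c := by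
  have h1 := S.e_sub_le hf hg (S.const_mem_Hb c) fun ω => by linarith [(abs_le.1 (h ω)).2]
  have h2 := S.e_sub_le hg hf (S.const_mem_Hb c) fun ω => by linarith [(abs_le.1 (h ω)).1]
  rw [S.e_const] at h1 h2
  exact abs_le.2 ⟨by linarith, by linarith⟩

theorem abs_e_le {f : Ω → ℝ} (hf : f ∈ S.Hb) {M : ℝ} (h : ∀ ω, |f ω| ≤ M) : |S.e f| ≤ M := by
  have := S.abs_e_sub_le hf (S.const_mem_Hb 0) (c := M) (by simpa using h)
  simpa [S.e_const] using this

theorem toENNReal_E_sum_le {g : ℕ → Ω → ℝ} (hg : ∀ i, g i ∈ S.H) (h0 : ∀ i ω, 0 ≤ g i ω) (n : ℕ) :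
    (S.E (∑ i ∈ Finset.range n, g i)).toENNReal ≤
      ∑ i ∈ Finset.range n, (S.E (g i)).toENNReal := by
  induction n with
  | zero =>
    have : S.E 0 = 0 := S.const 0
    simp [this]
  | succ n ih =>
    rw [Finset.sum_range_succ, Finset.sum_range_succ]
    have hs : ∑ i ∈ Finset.range n, g i ∈ S.H := S.H.sum_mem fun i _ => hg i
    have h1 : 0 ≤ S.E (∑ i ∈ Finset.range n, g i) := S.E_nonneg hs fun ω => by
      rw [Finset.sum_apply]
      exact Finset.sum_nonneg fun i _ => h0 i ω
    have h2 : 0 ≤ S.E (g n) := S.E_nonneg (hg n) (h0 n)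
    have h3 := S.subadd _ hs _ (hg n) (fun h => by simp [h.2] at h2) (fun h => by simp [h.1] at h1)
    refine (EReal.toENNReal_le_toENNReal h3).trans ?_
    rw [EReal.toENNReal_add h1 h2]
    gcongr

/-! ### The upper probability and the countably sub-additive capacities -/

theorem lintegral_le_of_mem_dominated {P : ProbabilityMeasure Ω} (hP : P ∈ S.dominated)
    {f : Ω → ℝ} (hf : f ∈ S.H) (h0 : ∀ ω, 0 ≤ f ω) :
    ∫⁻ ω, ENNReal.ofReal (f ω) ∂(P : Measure Ω) ≤ (S.E f).toENNReal := by
  have hfm := S.measurable_of_mem f hf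
  have key : ∀ ω, ENNReal.ofReal (f ω) = ⨆ n : ℕ, ENNReal.ofReal (min (f ω) n) := by
    intro ω
    refine le_antisymm ?_ (iSup_le fun n => ENNReal.ofReal_le_ofReal (min_le_left _ _))
    obtain ⟨n, hn⟩ := exists_nat_ge (f ω)
    exact le_iSup_of_le n (by rw [min_eq_left hn])
  simp_rw [key]
  rw [lintegral_iSup (fun n => (hfm.min measurable_const).ennreal_ofReal)
    (fun m n hmn ω => ENNReal.ofReal_le_ofReal (min_le_min_left _ (by exact_mod_cast hmn)))]
  refine iSup_le fun n => ?_
  have hb : ∀ ω, |min (f ω) n| ≤ n := fun ω => by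
    rw [abs_of_nonneg (le_min (h0 ω) n.cast_nonneg)]
    exact min_le_right _ _
  have hmem : (fun ω => min (f ω) n) ∈ S.Hb := ⟨S.min_const_mem hf n, n, hb⟩
  have h1 := (hP _ hmem).trans (S.mono f hf _ hmem.1 fun ω => min_le_left _ _)
  have hint : Integrable (fun ω => min (f ω) n) (P : Measure Ω) :=
    Integrable.of_bound (S.measurable_of_mem _ hmem.1).aestronglyMeasurable n
      (Eventually.of_forall hb)
  rw [← ofReal_integral_eq_lintegral_ofReal hint
    (Eventually.of_forall fun ω => le_min (h0 ω) n.cast_nonneg)]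
  simpa using EReal.toENNReal_le_toENNReal h1

theorem upperProb_le_one (A : Set Ω) : S.upperProb A ≤ 1 :=
  iSup₂_le fun _ _ => prob_le_one

theorem upperProb_mono {A B : Set Ω} (h : A ⊆ B) : S.upperProb A ≤ S.upperProb B :=
  iSup₂_mono fun _ _ => measure_mono h

theorem le_upperProb {P : ProbabilityMeasure Ω} (hP : P ∈ S.dominated) (A : Set Ω) :
    (P : Measure Ω) A ≤ S.upperProb A := le_iSup₂_of_le P hP le_rfl

theorem countablySubadditive_upperProb : CountablySubadditive S.upperProb := fun A _ =>
  iSup₂_le fun _ hP => (measure_iUnion_le A).trans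
    (ENNReal.tsum_le_tsum fun i => S.le_upperProb hP (A i))

theorem upperProb_le_cStar {A : Set Ω} (hA : MeasurableSet A) : S.upperProb A ≤ S.cStar A := by
  refine iSup₂_le fun P hP => ?_
  refine le_iInf fun g => le_iInf fun hg => le_iInf fun h0 => le_iInf fun hAg => ?_
  have hm : ∀ i, Measurable fun ω => ENNReal.ofReal (g i ω) := fun i =>
    (S.measurable_of_mem _ (hg i)).ennreal_ofReal
  calc (P : Measure Ω) A = ∫⁻ ω, A.indicator (fun _ => 1) ω ∂(P : Measure Ω) := by
        rw [lintegral_indicator hA]; simp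
    _ ≤ ∫⁻ ω, ∑' i, ENNReal.ofReal (g i ω) ∂(P : Measure Ω) := lintegral_mono hAg
    _ = ∑' i, ∫⁻ ω, ENNReal.ofReal (g i ω) ∂(P : Measure Ω) :=
        lintegral_tsum fun i => (hm i).aemeasurable
    _ = ⨆ n, ∑ i ∈ Finset.range n, ∫⁻ ω, ENNReal.ofReal (g i ω) ∂(P : Measure Ω) :=
        ENNReal.tsum_eq_iSup_nat
    _ ≤ _ := iSup_mono fun n => ?_
  rw [← lintegral_finsetSum _ fun i _ => hm i]
  refine le_trans (le_of_eq ?_) (S.lintegral_le_of_mem_dominated hP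
    (S.H.sum_mem fun i (_ : i ∈ Finset.range n) => hg i) fun ω => ?_)
  · refine lintegral_congr fun ω => ?_
    rw [Finset.sum_apply, ENNReal.ofReal_sum_of_nonneg fun i _ => h0 i ω]
  · rw [Finset.sum_apply]
    exact Finset.sum_nonneg fun i _ => h0 i ω

theorem upCap_le_one (A : Set Ω) : S.upCap A ≤ 1 := by
  refine iInf₂_le_of_le (fun _ => 1) (S.const_mem 1) (iInf_le_of_le (fun ω => ?_) ?_)
  · exact Set.indicator_le_self' (fun _ _ => zero_le_one) ω
  · rw [S.const 1, EReal.real_coe_toENNReal, ENNReal.ofReal_one]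

theorem upCap_empty : S.upCap ∅ = 0 := by
  refine le_antisymm ?_ zero_le
  refine iInf₂_le_of_le (fun _ => 0) (S.const_mem 0) (iInf_le_of_le (fun ω => ?_) ?_)
  · simp
  · simp [S.const 0]

theorem upCapStar_le_upCap {A : Set Ω} (hA : MeasurableSet A) : S.upCapStar A ≤ S.upCap A := by
  refine iInf₂_le_of_le (fun i => if i = 0 then A else ∅) (fun i => ?_) (iInf_le_of_le ?_ ?_)
  · dsimp only
    split_ifs
    exacts [hA, MeasurableSet.empty]
  · exact Set.subset_iUnion_of_subset 0 (by simp)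
  · rw [tsum_eq_single 0 fun i hi => by simp [hi, S.upCap_empty]]
    simp

theorem cStar_le_upCapStar (A : Set Ω) : S.cStar A ≤ S.upCapStar A := by
  refine le_iInf fun B => le_iInf fun hB => le_iInf fun hAB => ?_
  refine ENNReal.le_of_forall_pos_le_add fun ε hε _ => ?_
  obtain ⟨δ, hδ, hδε⟩ := ENNReal.exists_pos_sum_of_countable
    (ENNReal.coe_ne_zero.2 hε.ne') ℕ
  have : ∀ i, ∃ ξ ∈ S.H, (∀ ω, (B i).indicator (fun _ => (1 : ℝ)) ω ≤ ξ ω) ∧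
      (S.E ξ).toENNReal < S.upCap (B i) + δ i := by
    intro i
    have h : S.upCap (B i) < S.upCap (B i) + δ i :=
      ENNReal.lt_add_right ((S.upCap_le_one _).trans_lt ENNReal.one_lt_top).ne
        (ENNReal.coe_ne_zero.2 (hδ i).ne')
    conv_lhs at h => rw [upCap]
    simp only [iInf_lt_iff] at h
    obtain ⟨ξ, h1, h2, h3⟩ := h
    exact ⟨ξ, h1, h2, h3⟩
  choose ξ hξ hBξ hE using this
  have h0 : ∀ i ω, 0 ≤ ξ i ω := fun i ω =>
    (Set.indicator_nonneg (fun _ _ => zero_le_one) ω).trans (hBξ i ω)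
  refine iInf₂_le_of_le ξ hξ (iInf₂_le_of_le h0 (fun ω => ?_) ?_)
  · by_cases hω : ω ∈ A
    · obtain ⟨i, hi⟩ := Set.mem_iUnion.1 (hAB hω)
      have := hBξ i ω
      rw [Set.indicator_of_mem hi] at this
      rw [Set.indicator_of_mem hω]
      exact (ENNReal.one_le_ofReal.2 this).trans (ENNReal.le_tsum i)
    · simp [hω]
  · refine iSup_le fun n => (S.toENNReal_E_sum_le hξ h0 n).trans ?_
    calc _ ≤ ∑' i, (S.E (ξ i)).toENNReal := ENNReal.sum_le_tsum _
      _ ≤ ∑' i, (S.upCap (B i) + δ i) := ENNReal.tsum_le_tsum fun i => (hE i).le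
      _ = ∑' i, S.upCap (B i) + ∑' i, (δ i : ℝ≥0∞) := ENNReal.tsum_add
      _ ≤ _ := by gcongr

end SublinearExpectationSpace

end SubLin

namespace SubLin

/-! ### Truncation -/

/-- A continuous cut-off function, equal to `0` on `[-c, c]` and to `1` off `(-c - 1, c + 1)`. -/
noncomputable def ramp (c t : ℝ) : ℝ := min 1 (max 0 (|t| - c))

/-- The projection of the real line onto `[-c, c]`. -/
noncomputable def clip (c t : ℝ) : ℝ := max (-c) (min c t)

theorem ramp_nonneg (c t : ℝ) : 0 ≤ ramp c t := le_min zero_le_one (le_max_left _ _)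

theorem ramp_le_one (c t : ℝ) : ramp c t ≤ 1 := min_le_left _ _

theorem abs_ramp_le_one (c t : ℝ) : |ramp c t| ≤ 1 := by
  rw [abs_of_nonneg (ramp_nonneg c t)]
  exact ramp_le_one c t

theorem ramp_eq_one {c t : ℝ} (h : c + 1 ≤ |t|) : ramp c t = 1 :=
  min_eq_left ((by linarith : 1 ≤ |t| - c).trans (le_max_right _ _))

theorem ramp_eq_zero {c t : ℝ} (h : |t| ≤ c) : ramp c t = 0 := by
  rw [ramp, max_eq_left (by linarith), min_eq_right zero_le_one]

theorem ramp_anti {c d : ℝ} (h : c ≤ d) (t : ℝ) : ramp d t ≤ ramp c t :=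
  min_le_min_left _ (max_le_max_left _ (by linarith))

theorem abs_ramp_sub_le (c s t : ℝ) : |ramp c s - ramp c t| ≤ |s - t| := by
  have h1 : |ramp c s - ramp c t| ≤ |max 0 (|s| - c) - max 0 (|t| - c)| := by
    simpa [ramp] using abs_min_sub_min_le_max 1 (max 0 (|s| - c)) 1 (max 0 (|t| - c))
  have h2 : |max 0 (|s| - c) - max 0 (|t| - c)| ≤ |(|s| - c) - (|t| - c)| := by
    simpa using abs_max_sub_max_le_max 0 (|s| - c) 0 (|t| - c)
  refine h1.trans (h2.trans ?_)
  rw [sub_sub_sub_cancel_right]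
  exact abs_abs_sub_abs_le s t

theorem polyLip_ramp (c : ℝ) : PolyLip (ramp c) :=
  polyLip_of_lipschitz_one (C := 1) fun s t => by simpa using abs_ramp_sub_le c s t

theorem clip_eq_self {c t : ℝ} (h : |t| ≤ c) : clip c t = t := by
  rw [clip, min_eq_right (abs_le.1 h).2, max_eq_right (abs_le.1 h).1]

theorem abs_clip_le {c : ℝ} (hc : 0 ≤ c) (t : ℝ) : |clip c t| ≤ c :=
  abs_le.2 ⟨le_max_left _ _, max_le (by linarith) (min_le_left _ _)⟩

theorem abs_clip_sub_le (c s t : ℝ) : |clip c s - clip c t| ≤ |s - t| := by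
  have h1 : |clip c s - clip c t| ≤ |min c s - min c t| := by
    simpa [clip] using abs_max_sub_max_le_max (-c) (min c s) (-c) (min c t)
  exact h1.trans (by simpa using abs_min_sub_min_le_max c s c t)

theorem polyLip_clip (c : ℝ) : PolyLip (clip c) :=
  polyLip_of_lipschitz_one (C := 1) fun s t => by simpa using abs_clip_sub_le c s t

theorem ramp_clip {c : ℝ} (hc : 0 ≤ c) (t : ℝ) : ramp c (clip (c + 1) t) = ramp c t := by
  rcases le_total |t| (c + 1) with h | h
  · rw [clip_eq_self h]
  · rw [ramp_eq_one h, ramp_eq_one]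
    rcases le_abs.1 h with h | h
    · rw [clip, min_eq_left h, max_eq_right (by linarith), abs_of_nonneg (by linarith)]
    · rw [clip, min_eq_right (by linarith), max_eq_left (by linarith), abs_neg,
        abs_of_nonneg (by linarith)]

/-- The extension of `clip` to the extended real line. -/
noncomputable def eclip (c : ℝ) (z : EReal) : ℝ :=
  (max ((-c : ℝ) : EReal) (min (c : EReal) z)).toReal

theorem continuous_eclip (c : ℝ) : Continuous (eclip c) := by
  refine EReal.continuousOn_toReal.comp_continuous (by fun_prop) fun z => ?_
  simp only [Set.mem_compl_iff, Set.mem_insert_iff, Set.mem_singleton_iff, not_or]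
  constructor
  · exact ((EReal.bot_lt_coe _).trans_le (le_max_left _ _)).ne'
  · exact (max_lt (EReal.coe_lt_top _) ((min_le_left _ _).trans_lt (EReal.coe_lt_top _))).ne

theorem eclip_coe (c t : ℝ) : eclip c t = clip c t := by
  rw [eclip, clip, ← EReal.coe_strictMono.monotone.map_min,
    ← EReal.coe_strictMono.monotone.map_max, EReal.toReal_coe]

theorem eclip_top {c : ℝ} (hc : 0 ≤ c) : eclip c ⊤ = c := by
  rw [eclip, min_eq_left le_top, ← EReal.coe_strictMono.monotone.map_max, EReal.toReal_coe,
    max_eq_right (by linarith)]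

theorem eclip_bot (c : ℝ) : eclip c ⊥ = -c := by
  rw [eclip, min_eq_right bot_le, max_eq_left bot_le, EReal.toReal_coe]

namespace SublinearExpectationSpace

/-- A sub-linear expectation on the cylinder functions on `ℝ^∞` under which every coordinate is
tight. -/
structure IsCoordTight (T : SublinearExpectationSpace (ℕ → ℝ)) : Prop where
  mem_H_iff : ∀ f, f ∈ T.H ↔ f ∈ cylinderFunctions
  tight : ∀ (i : ℕ) (ε : ℝ), 0 < ε → ∃ c : ℝ, T.e (fun x => ramp c (x i)) ≤ ε

namespace IsCoordTight

variable {T : SublinearExpectationSpace (ℕ → ℝ)}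

theorem ramp_mem (hT : T.IsCoordTight) (c : ℝ) (i : ℕ) : (fun x : ℕ → ℝ => ramp c (x i)) ∈ T.Hb :=
  ⟨(hT.mem_H_iff _).2 (comp_one_mem_cylinderFunctions (coord_mem_cylinderFunctions i)
    (polyLip_ramp c)), 1, fun _ => abs_ramp_le_one c _⟩

theorem continuous (hT : T.IsCoordTight) {f : (ℕ → ℝ) → ℝ} (hf : f ∈ T.Hb) : Continuous f :=
  continuous_of_mem_cylinderFunctions ((hT.mem_H_iff _).1 hf.1)

theorem clip_mem (hT : T.IsCoordTight) {f : (ℕ → ℝ) → ℝ} (hf : f ∈ T.Hb) (c : ℝ) :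
    (fun x => f fun i => clip c (x i)) ∈ T.Hb := by
  obtain ⟨hf, M, hM⟩ := hf
  obtain ⟨n, φ, hφ, rfl⟩ := (hT.mem_H_iff _).1 hf
  refine ⟨(hT.mem_H_iff _).2 ⟨n, fun v => φ fun i => clip c (v i), ?_, rfl⟩, M,
    fun x => hM fun i => clip c (x i)⟩
  exact (hφ.polyLip.comp (PolyLip.pi fun i => (polyLip_clip c).comp (polyLip_apply i))).locLip

theorem exists_clip_remainder (hT : T.IsCoordTight) {f : (ℕ → ℝ) → ℝ} (hf : f ∈ T.Hb)
    {ε : ℝ} (hε : 0 < ε) :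
    ∃ c₀ : ℝ, ∀ c ≥ c₀, ∃ r ∈ T.Hb, (∀ x, |f x - f fun i => clip c (x i)| ≤ r x) ∧ T.e r ≤ ε := by
  obtain ⟨n, φ, hφ, hfφ⟩ := (hT.mem_H_iff _).1 hf.1
  obtain ⟨M, hM⟩ := hf.2
  have hM0 : 0 ≤ M := (abs_nonneg _).trans (hM 0)
  set δ : ℝ := ε / (2 * (M + 1) * (n + 1)) with hδ
  have hδ0 : 0 < δ := by positivity
  choose c hc using fun i : ℕ => hT.tight i δ hδ0
  refine ⟨∑ i ∈ Finset.range n, |c i| + 1, fun b hb => ?_⟩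
  have hmem : ∀ i ∈ Finset.range n, (fun x : ℕ → ℝ => ramp (b - 1) (x i)) ∈ T.Hb :=
    fun i _ => hT.ramp_mem _ _
  have hsum := T.boundedSubmodule.sum_mem hmem
  refine ⟨(2 * M) • ∑ i ∈ Finset.range n, fun x : ℕ → ℝ => ramp (b - 1) (x i),
    T.boundedSubmodule.smul_mem _ hsum, fun x => ?_, ?_⟩
  · simp only [Pi.smul_apply, Finset.sum_apply, smul_eq_mul]
    have hs : 0 ≤ ∑ i ∈ Finset.range n, ramp (b - 1) (x i) :=
      Finset.sum_nonneg fun i _ => ramp_nonneg _ _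
    by_cases h : ∀ i < n, |x i| ≤ b
    · have : f x = f fun i => clip b (x i) := by
        rw [hfφ]
        dsimp only
        congr 1
        ext i
        rw [clip_eq_self (h i i.2)]
      rw [this]
      simp only [sub_self, abs_zero]
      positivity
    · push Not at h
      obtain ⟨i, hi, hxi⟩ := h
      have h1 : 1 ≤ ∑ i ∈ Finset.range n, ramp (b - 1) (x i) := by
        refine (ramp_eq_one (c := b - 1) (t := x i) (by linarith)).ge.trans ?_
        exact Finset.single_le_sum (f := fun i => ramp (b - 1) (x i))
          (fun i _ => ramp_nonneg _ _) (Finset.mem_range.2 hi)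
      have h2 : |f x - f fun i => clip b (x i)| ≤ 2 * M := by
        have := abs_sub (f x) (f fun i => clip b (x i))
        linarith [hM x, hM fun i => clip b (x i)]
      nlinarith
  · rw [T.e_smul hsum (by positivity)]
    have h1 : ∑ i ∈ Finset.range n, T.e (fun x : ℕ → ℝ => ramp (b - 1) (x i)) ≤ n * δ := by
      rw [← nsmul_eq_mul]
      refine (Finset.sum_le_card_nsmul _ _ δ fun i hi => ?_).trans_eq (by rw [Finset.card_range])
      refine (T.e_mono (hT.ramp_mem _ _) (hT.ramp_mem _ _) fun x => ramp_anti ?_ _).trans (hc i)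
      have := Finset.single_le_sum (f := fun i => |c i|) (fun i _ => abs_nonneg _) hi
      have h3 := le_abs_self (c i)
      linarith
    calc 2 * M * T.e _ ≤ 2 * M * (n * δ) := by
          gcongr
          exact (T.e_sum_le _ hmem).trans h1
      _ ≤ 2 * (M + 1) * ((n + 1) * δ) := by gcongr <;> linarith
      _ = ε := by rw [hδ]; field_simp

end IsCoordTight

end SublinearExpectationSpace

end SubLin

namespace SubLin

namespace SublinearExpectationSpace

variable {Ω : Type*} [MeasurableSpace Ω] (S : SublinearExpectationSpace Ω)

/-! ### Linear functionals dominated by a sub-linear expectation -/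

theorem e_neg_ge {f : Ω → ℝ} (hf : f ∈ S.Hb) : -S.e f ≤ S.e (-f) := by
  have := S.e_add_le hf (S.boundedSubmodule.neg_mem hf)
  rw [add_neg_cancel, S.e_zero] at this
  linarith

theorem exists_linear_le_of_ne_zero {f : Ω → ℝ} (hf : f ∈ S.Hb) (hf0 : f ≠ 0) :
    ∃ L : S.boundedSubmodule →ₗ[ℝ] ℝ, L ⟨f, hf⟩ = S.e f ∧ ∀ g, L g ≤ S.e g := by
  have hne : (⟨f, hf⟩ : S.boundedSubmodule) ≠ 0 := fun h => hf0 (congrArg Subtype.val h)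
  obtain ⟨L, h1, h2⟩ := exists_extension_of_le_sublinear
    (LinearPMap.mkSpanSingleton (⟨f, hf⟩ : S.boundedSubmodule) (S.e f) hne)
    (fun g => S.e g) (fun c hc g => S.e_smul g.2 hc.le) (fun g h => S.e_add_le g.2 h.2) (by
      rintro ⟨x, hx⟩
      obtain ⟨c, rfl⟩ := Submodule.mem_span_singleton.1 hx
      rw [LinearPMap.mkSpanSingleton'_apply]
      change c * S.e f ≤ S.e (c • f)
      rcases le_total 0 c with hc | hc
      · rw [S.e_smul hf hc]
      · have h1 := S.e_neg_ge (S.boundedSubmodule.smul_mem (-c) hf)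
        rw [S.e_smul hf (by linarith), neg_smul, neg_neg] at h1
        linarith)
  refine ⟨L, ?_, h2⟩
  have := h1 ⟨⟨f, hf⟩, Submodule.mem_span_singleton_self _⟩
  rw [this]
  exact LinearPMap.mkSpanSingleton_apply ℝ ℝ hne (S.e f)

theorem exists_linearExpectation_eq {f : Ω → ℝ} (hf : f ∈ S.Hb) :
    ∃ L : (Ω → ℝ) → ℝ, IsLinearExpectationOn S.Hb L ∧ L f = S.e f ∧ ∀ g ∈ S.Hb, L g ≤ S.e g := by
  classical
  have : ∃ L : S.boundedSubmodule →ₗ[ℝ] ℝ, L ⟨f, hf⟩ = S.e f ∧ ∀ g, L g ≤ S.e g := by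
    by_cases hf0 : f = 0
    · subst hf0
      by_cases h1 : (fun _ => 1 : Ω → ℝ) = 0
      · refine ⟨0, S.e_zero.symm, fun g => ?_⟩
        have : (g : Ω → ℝ) = 0 := by
          ext ω
          exact absurd (congrFun h1 ω) one_ne_zero
        rw [this, S.e_zero]
        simp
      · obtain ⟨L, -, hL⟩ := S.exists_linear_le_of_ne_zero (S.const_mem_Hb 1) h1
        exact ⟨L, (map_zero L).trans S.e_zero.symm, hL⟩
    · exact S.exists_linear_le_of_ne_zero hf hf0
  obtain ⟨L, hLf, hL⟩ := this
  set L' : (Ω → ℝ) → ℝ := fun g => if h : g ∈ S.boundedSubmodule then L ⟨g, h⟩ else 0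
  have hL' : ∀ g (h : g ∈ S.boundedSubmodule), L' g = L ⟨g, h⟩ := fun g h => dif_pos h
  have hle : ∀ g ∈ S.boundedSubmodule, L' g ≤ S.e g := fun g h => by rw [hL' g h]; exact hL ⟨g, h⟩
  have hadd : ∀ g ∈ S.Hb, ∀ h ∈ S.Hb, L' (g + h) = L' g + L' h := fun g hg h hh => by
    rw [hL' g hg, hL' h hh, hL' _ (S.boundedSubmodule.add_mem hg hh), ← map_add]
    rfl
  have hsmul : ∀ g ∈ S.Hb, ∀ c : ℝ, L' (c • g) = c * L' g := fun g hg c => by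
    rw [hL' g hg, hL' _ (S.boundedSubmodule.smul_mem c hg), ← smul_eq_mul, ← map_smul]
    rfl
  have hneg : ∀ g ∈ S.Hb, L' (-g) = -L' g := fun g hg => by
    simpa using hsmul g hg (-1)
  refine ⟨L', ⟨fun g hg h hh hgh => ?_, fun c => ?_, hadd, hsmul⟩, (hL' f hf).trans hLf, hle⟩
  · have h1 := hle _ (S.boundedSubmodule.sub_mem hh hg)
    have h2 : S.e (h - g) ≤ 0 := by
      rw [← S.e_zero]
      exact S.e_mono (S.boundedSubmodule.sub_mem hh hg) S.boundedSubmodule.zero_mem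
        fun ω => sub_nonpos.2 (hgh ω)
    rw [sub_eq_add_neg, hadd _ hh _ (S.boundedSubmodule.neg_mem hg), hneg g hg,
      ← sub_eq_add_neg] at h1
    rw [sub_eq_add_neg] at h2
    linarith
  · have h1 := hle _ (S.const_mem_Hb c)
    have h2 := hle _ (S.const_mem_Hb (-c))
    have h3 := hneg _ (S.const_mem_Hb c)
    rw [S.e_const] at h1 h2
    have h4 : (-fun _ : Ω => c) = fun _ => -c := rfl
    rw [h4] at h3
    linarith

end SublinearExpectationSpace

namespace IsLinearExpectationOn

variable {Ω : Type*} [MeasurableSpace Ω] {S : SublinearExpectationSpace Ω} {L : (Ω → ℝ) → ℝ}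

theorem abs_sub_le (hL : IsLinearExpectationOn S.Hb L) {f g r : Ω → ℝ} (hf : f ∈ S.Hb)
    (hg : g ∈ S.Hb) (hr : r ∈ S.Hb) (h : ∀ ω, |f ω - g ω| ≤ r ω) : |L f - L g| ≤ L r := by
  have h1 := hL.mono _ (S.boundedSubmodule.add_mem hg hr) f hf
    fun ω => by simpa using sub_le_iff_le_add'.1 (abs_le.1 (h ω)).2
  have h2 := hL.mono _ (S.boundedSubmodule.add_mem hf hr) g hg
    fun ω => by
      have := (abs_le.1 (h ω)).1
      simp only [Pi.add_apply]
      linarith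
  rw [hL.add _ hg _ hr] at h1
  rw [hL.add _ hf _ hr] at h2
  exact abs_le.2 ⟨by linarith, by linarith⟩

end IsLinearExpectationOn

namespace SublinearExpectationSpace.IsCoordTight

open scoped BoundedContinuousFunction CompactlySupported

variable {T : SublinearExpectationSpace (ℕ → ℝ)}

/-- A linear expectation on the bounded cylinder functions extends to a positive functional on the
bounded continuous functions. -/
theorem exists_positive_extension {L : ((ℕ → ℝ) → ℝ) → ℝ}
    (hL : IsLinearExpectationOn T.Hb L) :
    ∃ Λ : ((ℕ → ℝ) →ᵇ ℝ) →ₗ[ℝ] ℝ, (∀ f : (ℕ → ℝ) →ᵇ ℝ, ⇑f ∈ T.Hb → Λ f = L f) ∧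
      ∀ f : (ℕ → ℝ) →ᵇ ℝ, (∀ x, 0 ≤ f x) → 0 ≤ Λ f := by
  let D : Submodule ℝ ((ℕ → ℝ) →ᵇ ℝ) :=
    { carrier := {f | ⇑f ∈ T.Hb}
      add_mem' := fun {f g} hf hg => T.boundedSubmodule.add_mem hf hg
      zero_mem' := T.boundedSubmodule.zero_mem
      smul_mem' := fun c f hf => T.boundedSubmodule.smul_mem c hf }
  let L₀ : D →ₗ[ℝ] ℝ :=
    { toFun := fun f => L f.1
      map_add' := fun f g => hL.add _ f.2 _ g.2
      map_smul' := fun c f => hL.smul _ f.2 c }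
  let s : PointedCone ℝ ((ℕ → ℝ) →ᵇ ℝ) :=
    { carrier := {f | ∀ x, 0 ≤ f x}
      add_mem' := fun {f g} hf hg x => add_nonneg (hf x) (hg x)
      zero_mem' := fun _ => le_rfl
      smul_mem' := fun c f hf x => mul_nonneg c.2 (hf x) }
  obtain ⟨Λ, h1, h2⟩ := riesz_extension s ⟨D, L₀⟩
    (fun f hf => by
      have := hL.mono _ f.2 _ (T.const_mem_Hb 0) hf
      rwa [hL.const] at this)
    (fun g => ⟨⟨BoundedContinuousFunction.const _ ‖g‖, T.const_mem_Hb _⟩, fun x => by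
      have := (abs_le.1 (g.norm_coe_le_norm x)).1
      simp only [BoundedContinuousFunction.coe_add, Pi.add_apply,
        BoundedContinuousFunction.const_apply]
      linarith⟩)
  exact ⟨Λ, fun f hf => h1 ⟨f, hf⟩, h2⟩

/-- A positive normalized functional on the bounded continuous functions on `ℝ^∞` is given by
a probability measure on `[-∞, ∞]^∞`, for the functions which extend continuously. -/
theorem exists_measure_ereal (Λ : ((ℕ → ℝ) →ᵇ ℝ) →ₗ[ℝ] ℝ)
    (hpos : ∀ f : (ℕ → ℝ) →ᵇ ℝ, (∀ x, 0 ≤ f x) → 0 ≤ Λ f)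
    (hone : Λ (BoundedContinuousFunction.const _ 1) = 1) :
    ∃ μ : Measure (ℕ → EReal), IsProbabilityMeasure μ ∧
      ∀ (F : (ℕ → EReal) → ℝ), Continuous F → ∀ f : (ℕ → ℝ) →ᵇ ℝ,
        (∀ x : ℕ → ℝ, f x = F fun i => (x i : EReal)) → ∫ z, F z ∂μ = Λ f := by
  let ι : C(ℕ → ℝ, ℕ → EReal) := ⟨fun x i => (x i : EReal),
    continuous_pi fun i => continuous_coe_real_ereal.comp (continuous_apply i)⟩
  let J : C_c(ℕ → EReal, ℝ) → ((ℕ → ℝ) →ᵇ ℝ) := fun F =>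
    F.toBoundedContinuousFunction.compContinuous ι
  have hJ : ∀ F G, (∀ z, F z ≤ G z) → Λ (J F) ≤ Λ (J G) := fun F G h => by
    have := hpos (J G - J F) fun x => sub_nonneg.2 (h _)
    rw [map_sub] at this
    linarith
  let Λ' : C_c(ℕ → EReal, ℝ) →ₚ[ℝ] ℝ :=
    { toFun := fun F => Λ (J F)
      map_add' := fun F G => by
        rw [← map_add]
        rfl
      map_smul' := fun c F => by
        rw [← map_smul]
        rfl
      monotone' := fun F G h => hJ F G h }
  have key : ∀ (F : (ℕ → EReal) → ℝ), Continuous F → ∀ f : (ℕ → ℝ) →ᵇ ℝ,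
      (∀ x : ℕ → ℝ, f x = F fun i => (x i : EReal)) →
        ∫ z, F z ∂(RealRMK.rieszMeasure Λ') = Λ f := by
    intro F hF f hf
    have h := RealRMK.integral_rieszMeasure Λ'
      ⟨⟨F, hF⟩, HasCompactSupport.of_compactSpace _⟩
    refine h.trans ?_
    change Λ (J _) = Λ f
    congr 1
    ext x
    exact (hf x).symm
  refine ⟨RealRMK.rieszMeasure Λ', ?_, key⟩
  rw [isProbabilityMeasure_iff_real]
  have := key (fun _ => 1) continuous_const (BoundedContinuousFunction.const _ 1) fun _ => rfl
  simpa [hone] using this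

/-- Daniell-type representation: a linear expectation on the bounded cylinder functions which is
dominated by `T` is the integral with respect to a probability measure. -/
theorem exists_probabilityMeasure (hT : T.IsCoordTight) {L : ((ℕ → ℝ) → ℝ) → ℝ}
    (hL : IsLinearExpectationOn T.Hb L) (hLe : ∀ f ∈ T.Hb, L f ≤ T.e f) :
    ∃ P : ProbabilityMeasure (ℕ → ℝ), ∀ f ∈ T.Hb, ∫ x, f x ∂(P : Measure (ℕ → ℝ)) = L f := by
  obtain ⟨Λ, hΛ, hpos⟩ := exists_positive_extension hL
  obtain ⟨μ, hμ, hμΛ⟩ := exists_measure_ereal Λ hpos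
    ((hΛ _ (T.const_mem_Hb 1)).trans (hL.const 1))
  have hμL : ∀ (F : (ℕ → EReal) → ℝ), Continuous F → ∀ f ∈ T.Hb,
      (∀ x : ℕ → ℝ, f x = F fun i => (x i : EReal)) → ∫ z, F z ∂μ = L f := by
    intro F hF f hf h
    obtain ⟨M, hM⟩ := hf.2
    let f' : (ℕ → ℝ) →ᵇ ℝ := BoundedContinuousFunction.ofNormedAddCommGroup f (hT.continuous hf) M hM
    rw [hμΛ F hF f' h]
    exact hΛ f' hf
  have hfin : ∀ᵐ z ∂μ, ∀ i, z i ≠ ⊤ ∧ z i ≠ ⊥ := by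
    refine ae_all_iff.2 fun i => ?_
    set B : Set (ℕ → EReal) := {z | ¬ (z i ≠ ⊤ ∧ z i ≠ ⊥)} with hB
    have hBm : MeasurableSet B := by
      have : B = (fun z : ℕ → EReal => z i) ⁻¹' {⊤, ⊥} := by
        ext z
        simp only [hB, Set.mem_ofPred_eq, Set.mem_preimage, Set.mem_insert_iff,
          Set.mem_singleton_iff]
        tauto
      rw [this]
      exact measurable_pi_apply i ((Set.toFinite _).measurableSet)
    have hle : μ.real B ≤ 0 := by
      refine le_of_forall_pos_le_add fun ε hε => ?_
      obtain ⟨c, hc⟩ := hT.tight i ε hε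
      set d := max c 0
      have hd : 0 ≤ d := le_max_right _ _
      have hcont : Continuous fun z : ℕ → EReal => ramp d (eclip (d + 1) (z i)) :=
        (polyLip_ramp d).continuous.comp ((continuous_eclip _).comp (continuous_apply i))
      have hI := hμL _ hcont _ (hT.ramp_mem d i) fun x => by rw [eclip_coe, ramp_clip hd]
      have h1 : L (fun x => ramp d (x i)) ≤ ε := (hLe _ (hT.ramp_mem d i)).trans
        ((T.e_mono (hT.ramp_mem d i) (hT.ramp_mem c i) fun x =>
          ramp_anti (le_max_left _ _) _).trans hc)
      have hint : Integrable (fun z : ℕ → EReal => ramp d (eclip (d + 1) (z i))) μ :=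
        Integrable.of_bound hcont.aestronglyMeasurable 1
          (Eventually.of_forall fun z => abs_ramp_le_one _ _)
      rw [zero_add]
      calc μ.real B = ∫ z, B.indicator (fun _ => (1 : ℝ)) z ∂μ := by
            rw [integral_indicator hBm]; simp
        _ ≤ ∫ z, ramp d (eclip (d + 1) (z i)) ∂μ := by
            refine integral_mono ((integrable_const 1).indicator hBm) hint fun z => ?_
            by_cases hz : z ∈ B
            · rw [Set.indicator_of_mem hz]
              refine (ramp_eq_one ?_).ge
              have : z i = ⊤ ∨ z i = ⊥ := by
                simp only [hB, Set.mem_ofPred_eq] at hz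
                tauto
              rcases this with h | h <;> rw [h]
              · rw [eclip_top (by linarith)]
                exact le_abs_self _
              · rw [eclip_bot, abs_neg]
                exact le_abs_self _
            · rw [Set.indicator_of_notMem hz]
              exact ramp_nonneg _ _
        _ ≤ ε := hI.trans_le h1
    have := le_antisymm hle measureReal_nonneg
    exact (measureReal_eq_zero_iff (measure_ne_top μ B)).1 this
  have hmeas : Measurable fun (z : ℕ → EReal) (i : ℕ) => (z i).toReal :=
    measurable_pi_lambda _ fun i => measurable_ereal_toReal.comp (measurable_pi_apply i)
  refine ⟨⟨μ.map fun z i => (z i).toReal, Measure.isProbabilityMeasure_map hmeas.aemeasurable⟩,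
    fun f hf => ?_⟩
  have hfc := hT.continuous hf
  obtain ⟨M, hM⟩ := hf.2
  rw [ProbabilityMeasure.coe_mk, integral_map hmeas.aemeasurable hfc.aestronglyMeasurable]
  have hFc : ∀ c, Continuous fun z : ℕ → EReal => f fun i => eclip c (z i) := fun c =>
    hfc.comp (continuous_pi fun i => (continuous_eclip c).comp (continuous_apply i))
  have lim1 : Tendsto (fun n : ℕ => ∫ z, f (fun i => eclip n (z i)) ∂μ) atTop
      (𝓝 (∫ z, f (fun i => (z i).toReal) ∂μ)) := by
    refine tendsto_integral_of_dominated_convergence (fun _ => M)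
      (fun n => (hFc n).aestronglyMeasurable) (integrable_const M)
      (fun n => Eventually.of_forall fun z => hM _) ?_
    filter_upwards [hfin] with z hz
    refine (hfc.tendsto _).comp (tendsto_pi_nhds.2 fun i => ?_)
    lift z i to ℝ using hz i with t
    obtain ⟨N, hN⟩ := exists_nat_ge |t|
    refine tendsto_const_nhds.congr' ?_
    filter_upwards [eventually_ge_atTop N] with n hn
    rw [eclip_coe, clip_eq_self (hN.trans (by exact_mod_cast hn)), EReal.toReal_coe]
  have lim2 : Tendsto (fun n : ℕ => ∫ z, f (fun i => eclip n (z i)) ∂μ) atTop (𝓝 (L f)) := by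
    rw [Metric.tendsto_atTop']
    intro ε hε
    obtain ⟨c₀, hc₀⟩ := hT.exists_clip_remainder hf (half_pos hε)
    obtain ⟨N, hN⟩ := exists_nat_ge c₀
    refine ⟨N, fun n hn => ?_⟩
    obtain ⟨r, hr, hfr, hrε⟩ := hc₀ n (hN.trans (by exact_mod_cast hn.le))
    have hcl := hT.clip_mem hf n
    rw [hμL _ (hFc n) _ hcl fun x => by simp only [eclip_coe], Real.dist_eq, abs_sub_comm]
    have := hL.abs_sub_le hf hcl hr hfr
    linarith [hLe r hr]
  exact tendsto_nhds_unique lim1 lim2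

end SublinearExpectationSpace.IsCoordTight

end SubLin

namespace SubLin

namespace SublinearExpectationSpace

/-! ### The family of dominated probability measures -/

section

variable {Ω : Type*} [MeasurableSpace Ω] (S : SublinearExpectationSpace Ω)

theorem mem_dominated_iff {P : ProbabilityMeasure Ω} :
    P ∈ S.dominated ↔ ∀ f ∈ S.Hb, ∫ ω, f ω ∂(P : Measure Ω) ≤ S.e f :=
  forall₂_congr fun f hf => by rw [← S.coe_e hf, EReal.coe_le_coe_iff]

theorem measure_le_of_mem_dominated {P : ProbabilityMeasure Ω} (hP : P ∈ S.dominated) {A : Set Ω}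
    (hA : MeasurableSet A) {g : Ω → ℝ} (hg : g ∈ S.H)
    (h : ∀ ω, A.indicator (fun _ => (1 : ℝ)) ω ≤ g ω) :
    (P : Measure Ω) A ≤ (S.E g).toENNReal := by
  refine le_trans ?_ (S.lintegral_le_of_mem_dominated hP hg fun ω =>
    (Set.indicator_nonneg (fun _ _ => zero_le_one) ω).trans (h ω))
  rw [← lintegral_indicator_one hA]
  refine lintegral_mono fun ω => ?_
  by_cases hω : ω ∈ A
  · have := h ω
    rw [Set.indicator_of_mem hω] at this ⊢
    simpa using this
  · simp [hω]

end

namespace IsCoordTight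

variable {T : SublinearExpectationSpace (ℕ → ℝ)}

theorem integrable (hT : T.IsCoordTight) {f : (ℕ → ℝ) → ℝ} (hf : f ∈ T.Hb)
    (P : Measure (ℕ → ℝ)) [IsProbabilityMeasure P] : Integrable f P := by
  have hfc := hT.continuous hf
  obtain ⟨M, hM⟩ := hf.2
  exact Integrable.of_bound hfc.aestronglyMeasurable M (Eventually.of_forall hM)

theorem exists_mem_dominated_integral_eq (hT : T.IsCoordTight) {f : (ℕ → ℝ) → ℝ}
    (hf : f ∈ T.Hb) :
    ∃ P ∈ T.dominated, ∫ x, f x ∂(P : Measure (ℕ → ℝ)) = T.e f := by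
  obtain ⟨L, hL, hLf, hLe⟩ := T.exists_linearExpectation_eq hf
  obtain ⟨P, hP⟩ := hT.exists_probabilityMeasure hL hLe
  refine ⟨P, T.mem_dominated_iff.2 fun g hg => ?_, (hP f hf).trans hLf⟩
  rw [hP g hg]
  exact hLe g hg

theorem isClosed_dominated (hT : T.IsCoordTight) : IsClosed T.dominated := by
  have : T.dominated = ⋂ f ∈ T.Hb,
      {P : ProbabilityMeasure (ℕ → ℝ) | ∫ x, f x ∂(P : Measure (ℕ → ℝ)) ≤ T.e f} := by
    ext P
    simp only [Set.mem_iInter]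
    exact T.mem_dominated_iff
  rw [this]
  refine isClosed_biInter fun f hf => isClosed_le ?_ continuous_const
  obtain ⟨M, hM⟩ := hf.2
  exact ProbabilityMeasure.continuous_integral_boundedContinuousFunction
    (BoundedContinuousFunction.ofNormedAddCommGroup f (hT.continuous hf) M hM)

theorem isTightMeasureSet_dominated (hT : T.IsCoordTight) :
    IsTightMeasureSet {((P : ProbabilityMeasure (ℕ → ℝ)) : Measure (ℕ → ℝ)) | P ∈ T.dominated} := by
  rw [isTightMeasureSet_iff_exists_isCompact_measure_compl_le]
  intro ε hε
  obtain ⟨δ, hδ, hδε⟩ := ENNReal.exists_pos_sum_of_countable hε.ne' ℕ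
  choose c hc using fun i => hT.tight i (δ i) (hδ i)
  refine ⟨Set.univ.pi fun i => Set.Icc (-(c i + 1)) (c i + 1),
    isCompact_univ_pi fun i => isCompact_Icc, ?_⟩
  rintro _ ⟨P, hP, rfl⟩
  have hsub : (Set.univ.pi fun i => Set.Icc (-(c i + 1)) (c i + 1))ᶜ ⊆
      ⋃ i, {x : ℕ → ℝ | c i + 1 ≤ |x i|} := by
    intro x hx
    by_contra h
    simp only [Set.mem_iUnion, Set.mem_ofPred_eq, not_exists, not_le] at h
    exact hx fun i _ => abs_le.1 (h i).le
  calc (P : Measure (ℕ → ℝ)) _ ≤ _ := measure_mono hsub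
    _ ≤ ∑' i, (P : Measure (ℕ → ℝ)) {x : ℕ → ℝ | c i + 1 ≤ |x i|} := measure_iUnion_le _
    _ ≤ ∑' i, (δ i : ℝ≥0∞) := ENNReal.tsum_le_tsum fun i => ?_
    _ ≤ ε := hδε.le
  have hm := hT.ramp_mem (c i) i
  refine (T.measure_le_of_mem_dominated hP (measurableSet_le measurable_const
    (measurable_pi_apply i).abs) hm.1 fun x => ?_).trans ?_
  · by_cases hx : x ∈ {x : ℕ → ℝ | c i + 1 ≤ |x i|}
    · rw [Set.indicator_of_mem hx, ramp_eq_one hx]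
    · rw [Set.indicator_of_notMem hx]
      exact ramp_nonneg _ _
  · rw [← T.coe_e hm, EReal.real_coe_toENNReal]
    exact (ENNReal.ofReal_le_ofReal (hc i)).trans_eq (ENNReal.ofReal_coe_nnreal)

theorem isCompact_dominated (hT : T.IsCoordTight) : IsCompact T.dominated := by
  rw [← hT.isClosed_dominated.closure_eq]
  exact isCompact_closure_of_isTightMeasureSet hT.isTightMeasureSet_dominated

theorem E_eq_iSup (hT : T.IsCoordTight) {f : (ℕ → ℝ) → ℝ} (hf : f ∈ T.Hb) :
    T.E f = ⨆ P ∈ T.dominated, ((∫ x, f x ∂(P : Measure (ℕ → ℝ)) : ℝ) : EReal) := by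
  refine le_antisymm ?_ (iSup₂_le fun P hP => hP f hf)
  obtain ⟨P, hP, hPf⟩ := hT.exists_mem_dominated_integral_eq hf
  rw [← T.coe_e hf, ← hPf]
  exact le_iSup₂ (f := fun (P : ProbabilityMeasure (ℕ → ℝ)) (_ : P ∈ T.dominated) =>
    ((∫ x, f x ∂(P : Measure (ℕ → ℝ)) : ℝ) : EReal)) P hP

theorem isCapacity_upperProb (hT : T.IsCoordTight) : IsCapacity T.upperProb where
  empty := by simp [upperProb]
  univ := by
    obtain ⟨P, hP, -⟩ := hT.exists_mem_dominated_integral_eq (T.const_mem_Hb 0)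
    refine le_antisymm (T.upperProb_le_one _) ?_
    simpa using T.le_upperProb hP Set.univ
  mono _ _ _ _ h := T.upperProb_mono h

theorem sandwich_upperProb (hT : T.IsCoordTight) : T.Sandwich T.upperProb := by
  intro A hA f hf g hg h0 hfA hAg
  constructor
  · have hf1 : ∀ x, f x ≤ 1 := fun x =>
      (hfA x).trans (Set.indicator_le_self' (fun _ _ => zero_le_one) x)
    have hfb : f ∈ T.Hb := ⟨hf, 1, fun x => by rw [abs_of_nonneg (h0 x)]; exact hf1 x⟩
    obtain ⟨P, hP, hPf⟩ := hT.exists_mem_dominated_integral_eq hfb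
    have h1 : ∫ x, f x ∂(P : Measure (ℕ → ℝ)) ≤ (P : Measure (ℕ → ℝ)).real A := by
      have : (P : Measure (ℕ → ℝ)).real A =
          ∫ x, A.indicator (fun _ => (1 : ℝ)) x ∂(P : Measure (ℕ → ℝ)) := by
        rw [integral_indicator hA]; simp
      rw [this]
      exact integral_mono (hT.integrable hfb _) ((integrable_const 1).indicator hA) hfA
    rw [← T.coe_e hfb, ← hPf]
    refine (EReal.coe_le_coe_iff.2 h1).trans ?_
    rw [Measure.real, EReal.coe_ennreal_toReal (measure_ne_top _ _)]
    exact EReal.coe_ennreal_le_coe_ennreal_iff.2 (T.le_upperProb hP A)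
  · have h1 : T.upperProb A ≤ (T.E g).toENNReal :=
      iSup₂_le fun P hP => T.measure_le_of_mem_dominated hP hA hg hAg
    have h2 : 0 ≤ T.E g := T.E_nonneg hg fun x =>
      (h0 x).trans ((hfA x).trans (hAg x))
    rw [← EReal.coe_toENNReal h2]
    exact EReal.coe_ennreal_le_coe_ennreal_iff.2 h1

end IsCoordTight

end SublinearExpectationSpace

end SubLin

namespace SubLin

/-! ### Bounded Lipschitz cylinder functions -/

/-- Bounded Lipschitz functions of the first `d` coordinates. -/
def LipCylinder (d : ℕ) (f : (ℕ → ℝ) → ℝ) : Prop :=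
  (∃ M : ℝ, ∀ x, |f x| ≤ M) ∧
    ∃ K : ℝ, 0 ≤ K ∧ ∀ x y, |f x - f y| ≤ K * ∑ i ∈ Finset.range d, |x i - y i|

/-- The sequence which agrees with `x` before the index `a` and with `y` from `a` on. -/
def splice (a : ℕ) (x y : ℕ → ℝ) : ℕ → ℝ := fun j => if j < a then x j else y j

theorem splice_splice {a b : ℕ} (h : a ≤ b) (x y z : ℕ → ℝ) :
    splice b (splice a x y) z = splice a x (splice b y z) := by
  ext j
  simp only [splice]
  split_ifs <;> first | rfl | omega

theorem continuous_splice (a : ℕ) : Continuous fun p : (ℕ → ℝ) × (ℕ → ℝ) => splice a p.1 p.2 := by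
  refine continuous_pi fun j => ?_
  by_cases h : j < a
  · simp only [splice, h, if_true]
    fun_prop
  · simp only [splice, h, if_false]
    fun_prop

namespace LipCylinder

variable {d : ℕ} {f : (ℕ → ℝ) → ℝ}

theorem mono (hf : LipCylinder d f) {d' : ℕ} (h : d ≤ d') : LipCylinder d' f := by
  obtain ⟨hM, K, hK, hf⟩ := hf
  refine ⟨hM, K, hK, fun x y => (hf x y).trans ?_⟩
  gcongr

theorem congr (hf : LipCylinder d f) {x y : ℕ → ℝ} (h : ∀ i < d, x i = y i) : f x = f y := by
  obtain ⟨-, K, -, hf⟩ := hf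
  have := hf x y
  rw [Finset.sum_eq_zero fun i hi => by rw [h i (Finset.mem_range.1 hi), sub_self, abs_zero],
    mul_zero] at this
  exact sub_eq_zero.1 (abs_nonpos_iff.1 this)

theorem abs (hf : LipCylinder d f) : LipCylinder d fun x => |f x| := by
  obtain ⟨⟨M, hM⟩, K, hK, hf⟩ := hf
  exact ⟨⟨M, fun x => by simpa using hM x⟩, K, hK,
    fun x y => (abs_abs_sub_abs_le _ _).trans (hf x y)⟩

theorem splice_right (hf : LipCylinder d f) (a : ℕ) (x : ℕ → ℝ) :
    LipCylinder d fun y => f (splice a x y) := by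
  obtain ⟨⟨M, hM⟩, K, hK, hf⟩ := hf
  refine ⟨⟨M, fun y => hM _⟩, K, hK, fun y z => (hf _ _).trans
    (mul_le_mul_of_nonneg_left (Finset.sum_le_sum fun i _ => ?_) hK)⟩
  simp only [splice]
  split_ifs <;> simp

theorem abs_splice_sub_le (hf : LipCylinder d f) (a : ℕ) :
    ∃ K : ℝ, 0 ≤ K ∧ ∀ x y z, |f (splice a x z) - f (splice a y z)| ≤
      K * ∑ i ∈ Finset.range a, |x i - y i| := by
  obtain ⟨-, K, hK, hf⟩ := hf
  refine ⟨K, hK, fun x y z => (hf _ _).trans (mul_le_mul_of_nonneg_left ?_ hK)⟩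
  have : ∀ i, |splice a x z i - splice a y z i| = if i < a then |x i - y i| else 0 := fun i => by
    simp only [splice]
    split_ifs <;> simp
  simp only [this]
  rw [← Finset.sum_filter]
  refine Finset.sum_le_sum_of_subset_of_nonneg (fun i hi => ?_) fun _ _ _ => abs_nonneg _
  exact Finset.mem_range.2 (Finset.mem_filter.1 hi).2

theorem mem_cylinderFunctions (hf : LipCylinder d f) : f ∈ cylinderFunctions := by
  obtain ⟨-, K, hK, h⟩ := id hf
  refine ⟨d, fun v => f fun i => if h : i < d then v ⟨i, h⟩ else 0, ?_, ?_⟩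
  · refine (polyLip_of_lipschitz (C := K * d) (by positivity) fun v w => ?_).locLip
    refine (h _ _).trans ?_
    rw [mul_assoc]
    gcongr
    rw [← nsmul_eq_mul]
    refine (Finset.sum_le_card_nsmul _ _ ‖v - w‖ fun i hi => ?_).trans_eq
      (by rw [Finset.card_range])
    have hi := Finset.mem_range.1 hi
    simp only [hi, dif_pos]
    exact norm_le_pi_norm (v - w) ⟨i, hi⟩
  · ext x
    exact hf.congr fun i hi => by simp [hi]

end LipCylinder

namespace SublinearExpectationSpace

/-- The sub-linear expectation of `f` over the coordinates with index at least `a`, as a function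
of the others. -/
noncomputable def condE (T : SublinearExpectationSpace (ℕ → ℝ)) (a : ℕ) (f : (ℕ → ℝ) → ℝ)
    (x : ℕ → ℝ) : ℝ := T.e fun y => f (splice a x y)

namespace IsCoordTight

variable {T : SublinearExpectationSpace (ℕ → ℝ)}

theorem lipCylinder_mem (hT : T.IsCoordTight) {d : ℕ} {f : (ℕ → ℝ) → ℝ} (hf : LipCylinder d f) :
    f ∈ T.Hb := ⟨(hT.mem_H_iff _).2 hf.mem_cylinderFunctions, hf.1⟩

theorem lipCylinder_condE (hT : T.IsCoordTight) {d : ℕ} {f : (ℕ → ℝ) → ℝ} (hf : LipCylinder d f)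
    (a : ℕ) : LipCylinder a (T.condE a f) := by
  obtain ⟨M, hM⟩ := hf.1
  obtain ⟨K, hK, h⟩ := hf.abs_splice_sub_le a
  exact ⟨⟨M, fun x => T.abs_e_le (hT.lipCylinder_mem (hf.splice_right a x)) fun y => hM _⟩,
    K, hK, fun x y => T.abs_e_sub_le (hT.lipCylinder_mem (hf.splice_right a x))
      (hT.lipCylinder_mem (hf.splice_right a y)) fun z => h x y z⟩

/-- Independence of the sequence of coordinates, for bounded Lipschitz functions. -/
theorem e_condE_succ (hT : T.IsCoordTight) (hind : T.IndepSeq fun i x => x i) {b : ℕ} (hb : 1 ≤ b)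
    {f : (ℕ → ℝ) → ℝ} (hf : LipCylinder (b + 1) f) : T.e (T.condE b f) = T.e f := by
  let φ : (Fin b → ℝ) × (Fin 1 → ℝ) → ℝ := fun p =>
    f fun j => if h : j < b then p.1 ⟨j, h⟩ else p.2 0
  have hφ : ∀ x y : ℕ → ℝ, φ (fun i => x i, fun _ => y b) = f (splice b x y) := fun x y =>
    hf.congr fun i hi => by
      by_cases h : i < b
      · simp [splice, h]
      · have : i = b := by omega
        simp [splice, this]
  have hφ' : ∀ (u : Fin b → ℝ) (y : ℕ → ℝ),
      φ (u, fun _ => y b) = f (splice b (fun j => if h : j < b then u ⟨j, h⟩ else 0) y) :=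
    fun u y => by
      rw [← hφ]
      simp
  have hloc : LocLip φ := by
    obtain ⟨-, K, hK, h⟩ := hf
    refine (polyLip_of_lipschitz (C := K * ((b + 1 : ℕ) : ℝ)) (by positivity)
      fun p q => ?_).locLip
    refine (h _ _).trans ?_
    rw [mul_assoc]
    gcongr
    rw [← nsmul_eq_mul]
    refine (Finset.sum_le_card_nsmul _ _ ‖p - q‖ fun i hi => ?_).trans_eq
      (by rw [Finset.card_range])
    by_cases hi : i < b
    · simp only [hi, dif_pos]
      exact (norm_le_pi_norm (p.1 - q.1) ⟨i, hi⟩).trans (norm_fst_le (p - q))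
    · simp only [hi, dif_neg, not_false_eq_true]
      exact (norm_le_pi_norm (p.2 - q.2) 0).trans (norm_snd_le (p - q))
  have hbar : (fun x : ℕ → ℝ => (T.E fun y => |φ (fun i => x i, fun _ => y b)|).toReal) =
      T.condE b fun x => |f x| := by
    ext x
    simp only [hφ]
    rfl
  have hg : (fun x : ℕ → ℝ => (T.E fun y => φ (fun i => x i, fun _ => y b)).toReal) =
      T.condE b f := by
    ext x
    simp only [hφ]
    rfl
  have hbarmem := hT.lipCylinder_condE hf.abs b
  have key := hind b hb φ hloc (fun u => T.E fun y => |φ (u, fun _ => y b)|)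
    (fun u => T.E fun y => φ (u, fun _ => y b)) (fun _ => rfl) (fun _ => rfl)
    (fun u => by
      simp only [hφ']
      rw [← T.coe_e (hT.lipCylinder_mem (hf.abs.splice_right b _))]
      exact EReal.coe_lt_top _)
    (by
      rw [hbar]
      exact (hT.lipCylinder_mem hbarmem).1)
    (by
      rw [hg]
      exact (hT.lipCylinder_mem (hT.lipCylinder_condE hf b)).1)
    (by
      have := T.coe_e (hT.lipCylinder_mem hbarmem.abs)
      rw [← hbar] at this
      rw [← this]
      exact EReal.coe_lt_top _)
  rw [hg] at key
  have hff : (fun x : ℕ → ℝ => φ (fun i => x i, fun _ => x b)) = f := by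
    ext x
    rw [hφ]
    congr 1
    ext j
    simp [splice]
  rw [hff] at key
  rw [e, e, key]

/-- Independence of the coordinates from `a` on of the coordinates before `a`, for bounded
Lipschitz functions. -/
theorem e_condE (hT : T.IsCoordTight) (hind : T.IndepSeq fun i x => x i) (a : ℕ) {b : ℕ}
    {f : (ℕ → ℝ) → ℝ} (hf : LipCylinder b f) : T.e (T.condE a f) = T.e f := by
  induction b generalizing f with
  | zero =>
    have : T.condE a f = f := by
      ext x
      have : (fun y => f (splice a x y)) = fun _ => f x := by
        ext y
        exact hf.congr fun i hi => absurd hi (Nat.not_lt_zero i)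
      rw [condE, this, T.e_const]
    rw [this]
  | succ b ih =>
    rcases Nat.eq_zero_or_pos a with rfl | ha
    · have : T.condE 0 f = fun _ => T.e f := by
        ext x
        have : ∀ y, splice 0 x y = y := fun y => by
          ext j
          simp [splice]
        simp only [condE, this]
      rw [this, T.e_const]
    rcases Nat.lt_or_ge b a with hab | hab
    · have : T.condE a f = f := by
        ext x
        have : (fun y => f (splice a x y)) = fun _ => f x := by
          ext y
          refine hf.congr fun i hi => ?_
          simp only [splice]
          rw [if_pos (by omega)]
        rw [condE, this, T.e_const]
      rw [this]
    · have hb : 1 ≤ b := le_trans ha hab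
      have : T.condE a f = T.condE a (T.condE b f) := by
        ext x
        have h := hT.e_condE_succ hind hb (hf.splice_right a x)
        rw [condE, ← h]
        congr 1
        ext y
        simp only [condE, splice_splice hab]
      rw [this, ih (hT.lipCylinder_condE hf b), hT.e_condE_succ hind hb hf]

/-- A probability measure is dominated as soon as this holds for bounded Lipschitz functions. -/
theorem mem_dominated_of_lipCylinder (hT : T.IsCoordTight) {P : ProbabilityMeasure (ℕ → ℝ)}
    (h : ∀ d f, LipCylinder d f → ∫ x, f x ∂(P : Measure (ℕ → ℝ)) ≤ T.e f) : P ∈ T.dominated := by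
  refine T.mem_dominated_iff.2 fun f hf => ?_
  have hfc := hT.continuous hf
  obtain ⟨M, hM⟩ := hf.2
  have hlip : ∀ n : ℕ, ∃ d, LipCylinder d fun x => f fun i => clip n (x i) := by
    intro n
    obtain ⟨d, φ, ⟨C, hC, m, hφ⟩, rfl⟩ := (hT.mem_H_iff _).1 hf.1
    refine ⟨d, ⟨M, fun x => hM fun i => clip n (x i)⟩,
      C * (1 + (n : ℝ) ^ m + (n : ℝ) ^ m), by positivity, fun x y => (hφ _ _).trans ?_⟩
    have hb : ∀ x : ℕ → ℝ, ‖fun i : Fin d => clip n (x i)‖ ≤ n := fun x =>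
      (pi_norm_le_iff_of_nonneg n.cast_nonneg).2 fun i => abs_clip_le n.cast_nonneg _
    gcongr
    · exact hb x
    · exact hb y
    · refine (pi_norm_le_iff_of_nonneg (Finset.sum_nonneg fun _ _ => abs_nonneg _)).2 fun i => ?_
      refine (abs_clip_sub_le n _ _).trans ?_
      exact Finset.single_le_sum (f := fun i => |x i - y i|) (fun _ _ => abs_nonneg _)
        (Finset.mem_range.2 i.2)
  have lim : Tendsto (fun n : ℕ => ∫ x, f (fun i => clip n (x i)) ∂(P : Measure (ℕ → ℝ))) atTop
      (𝓝 (∫ x, f x ∂(P : Measure (ℕ → ℝ)))) := by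
    refine tendsto_integral_of_dominated_convergence (fun _ => M)
      (fun n => (hT.continuous (hT.clip_mem hf n)).aestronglyMeasurable) (integrable_const M)
      (fun n => Eventually.of_forall fun z => hM _) (Eventually.of_forall fun x => ?_)
    refine (hfc.tendsto x).comp (tendsto_pi_nhds.2 fun i => ?_)
    obtain ⟨N, hN⟩ := exists_nat_ge |x i|
    refine tendsto_const_nhds.congr' ?_
    filter_upwards [eventually_ge_atTop N] with n hn
    rw [clip_eq_self (hN.trans (by exact_mod_cast hn))]
  refine le_of_forall_pos_le_add fun ε hε => ?_
  obtain ⟨c₀, hc₀⟩ := hT.exists_clip_remainder hf hε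
  obtain ⟨N, hN⟩ := exists_nat_ge c₀
  refine le_of_tendsto lim ?_
  filter_upwards [eventually_ge_atTop N] with n hn
  obtain ⟨r, hr, hfr, hrε⟩ := hc₀ n (hN.trans (by exact_mod_cast hn))
  obtain ⟨d, hd⟩ := hlip n
  have := T.e_sub_le (hT.clip_mem hf n) hf hr fun x => by linarith [(abs_le.1 (hfr x)).1]
  linarith [h d _ hd]

end IsCoordTight

end SublinearExpectationSpace

end SubLin

namespace SubLin

/-! ### Products of dominated measures along blocks -/

theorem exists_lt_apply_succ {n : ℕ → ℕ} (hn : StrictMono n) (j : ℕ) : ∃ k, j < n (k + 1) :=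
  ⟨j, (Nat.lt_succ_self j).trans_le (hn.le_apply)⟩

/-- The index of the block containing `j`; the indices before `n 0` are added to the first
block. -/
noncomputable def blockIndex {n : ℕ → ℕ} (hn : StrictMono n) (j : ℕ) : ℕ :=
  Nat.find (exists_lt_apply_succ hn j)

theorem blockIndex_le {n : ℕ → ℕ} (hn : StrictMono n) {j k : ℕ} (h : j < n (k + 1)) :
    blockIndex hn j ≤ k := Nat.find_min' _ h

theorem blockIndex_eq {n : ℕ → ℕ} (hn : StrictMono n) {j k : ℕ} (h : n k ≤ j)
    (h' : j < n (k + 1)) : blockIndex hn j = k := by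
  refine le_antisymm (blockIndex_le hn h') (not_lt.1 fun hlt => ?_)
  have h1 : j < n (blockIndex hn j + 1) := Nat.find_spec (exists_lt_apply_succ hn j)
  have h2 : n (blockIndex hn j + 1) ≤ n k := hn.monotone hlt
  omega

/-- The sequence whose `k`-th block is that of the `k`-th given sequence. -/
noncomputable def glue {n : ℕ → ℕ} (hn : StrictMono n) (z : ℕ → ℕ → ℝ) : ℕ → ℝ :=
  fun j => z (blockIndex hn j) j

theorem measurable_glue {n : ℕ → ℕ} (hn : StrictMono n) : Measurable (glue hn) :=
  measurable_pi_lambda _ fun _ => (measurable_pi_apply _).comp (measurable_pi_apply _)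

theorem glue_block {n : ℕ → ℕ} (hn : StrictMono n) (z : ℕ → ℕ → ℝ) (k : ℕ)
    (i : Fin (n (k + 1) - n k)) : glue hn z (n k + i) = z k (n k + i) := by
  rw [glue, blockIndex_eq hn (k := k) (by omega) (by have := i.2; omega)]

theorem indepFun_glue_prefix {n : ℕ → ℕ} (hn : StrictMono n) (P : ℕ → Measure (ℕ → ℝ))
    [∀ k, IsProbabilityMeasure (P k)] (k : ℕ) :
    ∃ A : (ℕ → ℕ → ℝ) → ℕ → ℝ, Measurable A ∧ (∀ z, ∀ j < n (k + 1), A z j = glue hn z j) ∧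
      IndepFun A (fun z => z (k + 1)) (Measure.infinitePi P) := by
  have hind : iIndepFun (fun (i : ℕ) (z : ℕ → ℕ → ℝ) => z i) (Measure.infinitePi P) :=
    iIndepFun_infinitePi (X := fun _ ω => ω) fun _ => measurable_id
  have h := hind.indepFun_finset (Finset.range (k + 1)) {k + 1} (by simp)
    fun i => measurable_pi_apply i
  let R : (Finset.range (k + 1) → ℕ → ℝ) → ℕ → ℝ := fun w j =>
    if hj : blockIndex hn j ∈ Finset.range (k + 1) then w ⟨blockIndex hn j, hj⟩ j else 0
  have hR : Measurable R := by
    refine measurable_pi_lambda _ fun j => ?_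
    by_cases hj : blockIndex hn j ∈ Finset.range (k + 1)
    · simp only [R, hj, dif_pos]
      exact (measurable_pi_apply _).comp (measurable_pi_apply _)
    · simp only [R, hj, dif_neg, not_false_eq_true]
      exact measurable_const
  have hres : Measurable fun (z : ℕ → ℕ → ℝ) (i : Finset.range (k + 1)) => z i :=
    measurable_pi_lambda _ fun i => measurable_pi_apply _
  refine ⟨fun z => R fun i => z i, hR.comp hres,
    fun z j hj => ?_, ?_⟩
  · have : blockIndex hn j ∈ Finset.range (k + 1) :=
      Finset.mem_range.2 (Nat.lt_succ_of_le (blockIndex_le hn hj))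
    simp only [R, this, dif_pos]
    rfl
  · exact h.comp hR (measurable_pi_apply (⟨k + 1, Finset.mem_singleton_self _⟩ :
      ({k + 1} : Finset ℕ)))

namespace SublinearExpectationSpace.IsCoordTight

variable {T : SublinearExpectationSpace (ℕ → ℝ)}

theorem integral_glue_le (hT : T.IsCoordTight) (hind : T.IndepSeq fun i x => x i) {n : ℕ → ℕ}
    (hn : StrictMono n) {P : ℕ → ProbabilityMeasure (ℕ → ℝ)} (hP : ∀ k, P k ∈ T.dominated)
    (k : ℕ) {f : (ℕ → ℝ) → ℝ} (hf : LipCylinder (n (k + 1)) f) :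
    ∫ z, f (glue hn z) ∂(Measure.infinitePi fun k => (P k : Measure (ℕ → ℝ))) ≤ T.e f := by
  set μ := Measure.infinitePi fun k => (P k : Measure (ℕ → ℝ))
  have hdom : ∀ k, ∀ g ∈ T.Hb, ∫ x, g x ∂(P k : Measure (ℕ → ℝ)) ≤ T.e g := fun k =>
    T.mem_dominated_iff.1 (hP k)
  induction k generalizing f with
  | zero =>
    have hfm := hT.lipCylinder_mem hf
    have h1 : ∀ z, f (glue hn z) = f (z 0) := fun z => hf.congr fun j hj => by
      rw [glue, Nat.le_zero.1 (blockIndex_le hn hj)]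
    simp only [h1]
    rw [← integral_map (μ := μ) (φ := fun z => z 0) (measurable_pi_apply 0).aemeasurable
      (hT.continuous hfm).aestronglyMeasurable, Measure.infinitePi_map_eval]
    exact hdom 0 f hfm
  | succ k ih =>
    obtain ⟨A, hA, hAg, hAi⟩ := indepFun_glue_prefix hn (fun k => (P k : Measure (ℕ → ℝ))) k
    set N := n (k + 1)
    have hfm := hT.lipCylinder_mem hf
    have hfc := hT.continuous hfm
    obtain ⟨M, hM⟩ := hf.1
    have h1 : ∀ z, f (glue hn z) = f (splice N (A z) (z (k + 1))) := fun z =>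
      hf.congr fun j hj => by
        rw [splice]
        split_ifs with h
        · exact (hAg z j h).symm
        · rw [glue, blockIndex_eq hn (not_lt.1 h) hj]
    have hcond := hT.lipCylinder_condE hf N
    have hcondm := hT.lipCylinder_mem hcond
    have h2 : ∀ z, T.condE N f (glue hn z) = T.condE N f (A z) := fun z =>
      hcond.congr fun j hj => (hAg z j hj).symm
    have hev : Measurable fun z : ℕ → ℕ → ℝ => z (k + 1) := measurable_pi_apply _
    have hprod : μ.map (fun z => (A z, z (k + 1))) =
        (μ.map A).prod (P (k + 1) : Measure (ℕ → ℝ)) := by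
      rw [hAi.map_prod_eq_prod_map_map hA.aemeasurable hev.aemeasurable]
      congr 1
      exact Measure.infinitePi_map_eval (fun k => (P k : Measure (ℕ → ℝ))) (k + 1)
    have : IsProbabilityMeasure (μ.map A) := Measure.isProbabilityMeasure_map hA.aemeasurable
    have hFc : Continuous fun p : (ℕ → ℝ) × (ℕ → ℝ) => f (splice N p.1 p.2) :=
      hfc.comp (continuous_splice N)
    have hFint : Integrable (fun p : (ℕ → ℝ) × (ℕ → ℝ) => f (splice N p.1 p.2))
        ((μ.map A).prod (P (k + 1) : Measure (ℕ → ℝ))) :=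
      Integrable.of_bound hFc.aestronglyMeasurable M (Eventually.of_forall fun _ => hM _)
    calc ∫ z, f (glue hn z) ∂μ = ∫ z, f (splice N (A z) (z (k + 1))) ∂μ := by simp only [h1]
      _ = ∫ p, f (splice N p.1 p.2) ∂(μ.map A).prod (P (k + 1) : Measure (ℕ → ℝ)) := by
        rw [← hprod, integral_map (hA.prodMk hev).aemeasurable hFc.aestronglyMeasurable]
      _ = ∫ x, ∫ y, f (splice N x y) ∂(P (k + 1) : Measure (ℕ → ℝ)) ∂(μ.map A) :=
        integral_prod _ hFint
      _ ≤ ∫ x, T.condE N f x ∂(μ.map A) :=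
        integral_mono hFint.integral_prod_left (hT.integrable hcondm _) fun x =>
          hdom (k + 1) _ (hT.lipCylinder_mem (hf.splice_right N x))
      _ = ∫ z, T.condE N f (glue hn z) ∂μ := by
        rw [integral_map hA.aemeasurable (hT.continuous hcondm).aestronglyMeasurable]
        simp only [h2]
      _ ≤ T.e (T.condE N f) := ih hcond
      _ = T.e f := hT.e_condE hind N hf

/-- Gluing the blocks of dominated probability measures independently gives a dominated
probability measure. -/
theorem exists_mem_dominated_blocks (hT : T.IsCoordTight) (hind : T.IndepSeq fun i x => x i)
    {n : ℕ → ℕ} (hn : StrictMono n) {P : ℕ → ProbabilityMeasure (ℕ → ℝ)}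
    (hP : ∀ k, P k ∈ T.dominated) :
    ∃ Q ∈ T.dominated,
      iIndepFun (fun (k : ℕ) (x : ℕ → ℝ) (i : Fin (n (k + 1) - n k)) => x (n k + i))
        (Q : Measure (ℕ → ℝ)) ∧
      ∀ (k : ℕ) (φ : (Fin (n (k + 1) - n k) → ℝ) → ℝ), Continuous φ →
        ∫ x, φ (fun i => x (n k + i)) ∂(Q : Measure (ℕ → ℝ)) =
          ∫ x, φ (fun i => x (n k + i)) ∂(P k : Measure (ℕ → ℝ)) := by
  set μ := Measure.infinitePi fun k => (P k : Measure (ℕ → ℝ))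
  have hG := measurable_glue hn
  have hblock : ∀ k, Measurable fun (x : ℕ → ℝ) (i : Fin (n (k + 1) - n k)) => x (n k + i) :=
    fun k => measurable_pi_lambda _ fun i => measurable_pi_apply _
  have hall : Measurable fun (x : ℕ → ℝ) (k : ℕ) (i : Fin (n (k + 1) - n k)) => x (n k + i) :=
    measurable_pi_lambda _ hblock
  have : IsProbabilityMeasure (μ.map (glue hn)) := Measure.isProbabilityMeasure_map hG.aemeasurable
  have hglue : ∀ k z, (fun i : Fin (n (k + 1) - n k) => glue hn z (n k + i)) =
      fun i : Fin (n (k + 1) - n k) => z k (n k + i) := fun k z => by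
    ext i
    exact glue_block hn z k i
  refine ⟨⟨μ.map (glue hn), this⟩, hT.mem_dominated_of_lipCylinder fun d f hf => ?_, ?_,
    fun k φ hφ => ?_⟩
  · rw [ProbabilityMeasure.coe_mk, integral_map hG.aemeasurable
      (hT.continuous (hT.lipCylinder_mem hf)).aestronglyMeasurable]
    exact hT.integral_glue_le hind hn hP d
      (hf.mono ((Nat.le_succ d).trans hn.le_apply))
  · rw [ProbabilityMeasure.coe_mk, iIndepFun_iff_map_fun_eq_infinitePi_map hblock,
      Measure.map_map hall hG]
    have h := iIndepFun_infinitePi (P := fun k => (P k : Measure (ℕ → ℝ)))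
      (X := fun k (x : ℕ → ℝ) (i : Fin (n (k + 1) - n k)) => x (n k + i)) hblock
    have h := h.map_fun_eq_infinitePi_map
      fun k => (hblock k).comp (measurable_pi_apply k)
    have h1 : ((fun (x : ℕ → ℝ) (k : ℕ) (i : Fin (n (k + 1) - n k)) => x (n k + i)) ∘ glue hn) =
        fun z k i => z k (n k + i) := by
      ext z k i
      exact glue_block hn z k i
    rw [h1]
    refine h.trans ?_
    congr 1
    ext1 k
    rw [Measure.map_map (hblock k) hG]
    congr 1
    ext z : 1
    exact (hglue k z).symm
  · have hφm : ∀ ν : Measure (ℕ → ℝ), AEStronglyMeasurable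
        (fun x : ℕ → ℝ => φ fun i => x (n k + i)) ν := fun ν =>
      (hφ.comp (by fun_prop)).aestronglyMeasurable
    rw [ProbabilityMeasure.coe_mk, integral_map hG.aemeasurable (hφm _)]
    simp only [hglue]
    rw [← Measure.infinitePi_map_eval (fun k => (P k : Measure (ℕ → ℝ))) k,
      integral_map (measurable_pi_apply k).aemeasurable (hφm _)]

end SublinearExpectationSpace.IsCoordTight

theorem BddLip.locLip {F : Type*} [NormedAddCommGroup F] {φ : F → ℝ} (h : BddLip φ) :
    LocLip φ := by
  obtain ⟨-, K, hK⟩ := h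
  exact (polyLip_of_lipschitz K.2 fun x y => hK.norm_sub_le x y).locLip

namespace SublinearExpectationSpace

variable {Ω : Type*} [MeasurableSpace Ω] (S : SublinearExpectationSpace Ω)

/-- Tightness of the random variables gives tightness of the coordinates. -/
theorem isCoordTight_ofSequence {V : Set Ω → ℝ≥0∞} (hSV : S.Sandwich V) {X : ℕ → Ω → ℝ}
    (hX : ∀ i, X i ∈ S.H) (ht : ∀ i, Tight V (X i)) : (S.ofSequence X hX).IsCoordTight := by
  refine ⟨fun f => Iff.rfl, fun i ε hε => ?_⟩
  have h1 : ∀ᶠ c : ℝ in atTop, V {ω | c ≤ |X i ω|} ≤ ENNReal.ofReal ε :=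
    (ht i).eventually_le_const (ENNReal.ofReal_pos.2 hε)
  obtain ⟨c, hc⟩ := h1.exists
  refine ⟨c, ?_⟩
  have hmem : (fun ω => ramp c (X i ω)) ∈ S.Hb :=
    ⟨S.comp_one_mem (hX i) (polyLip_ramp c), 1, fun _ => abs_ramp_le_one _ _⟩
  have h2 := (hSV {ω | c ≤ |X i ω|}
    (measurableSet_le measurable_const (S.measurable_of_mem _ (hX i)).abs) _ hmem.1
    (fun _ => 1) (S.const_mem 1) (fun _ => ramp_nonneg _ _) (fun ω => by
      by_cases h : ω ∈ {ω | c ≤ |X i ω|}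
      · rw [Set.indicator_of_mem h]
        exact ramp_le_one _ _
      · rw [Set.indicator_of_notMem h]
        exact (ramp_eq_zero (not_le.1 h).le).le)
    (fun ω => Set.indicator_le_self' (fun _ _ => zero_le_one) ω)).1
  change S.e (fun ω => ramp c (X i ω)) ≤ ε
  rw [← EReal.coe_le_coe_iff, S.coe_e hmem]
  refine h2.trans ?_
  calc (V {ω | c ≤ |X i ω|} : EReal) ≤ (ENNReal.ofReal ε : EReal) :=
        EReal.coe_ennreal_le_coe_ennreal_iff.2 hc
    _ = (ε : EReal) := by rw [EReal.coe_ennreal_ofReal, max_eq_left hε.le]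

theorem comp_sequence_mem_Hb {X : ℕ → Ω → ℝ} (hX : ∀ i, X i ∈ S.H) {f : (ℕ → ℝ) → ℝ}
    (hf : f ∈ (S.ofSequence X hX).Hb) : (fun ω => f fun i => X i ω) ∈ S.Hb := by
  obtain ⟨hf, M, hM⟩ := hf
  exact ⟨S.comp_sequence_mem hX hf, M, fun ω => hM _⟩

theorem isLinearExpectationOn_ofSequence {X : ℕ → Ω → ℝ} (hX : ∀ i, X i ∈ S.H)
    {L : (Ω → ℝ) → ℝ} (hL : IsLinearExpectationOn S.Hb L) :
    IsLinearExpectationOn (S.ofSequence X hX).Hb fun f => L fun ω => f fun i => X i ω where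
  mono _ hf _ hg h := hL.mono _ (S.comp_sequence_mem_Hb hX hf) _ (S.comp_sequence_mem_Hb hX hg)
    fun _ => h _
  const c := hL.const c
  add _ hf _ hg := hL.add _ (S.comp_sequence_mem_Hb hX hf) _ (S.comp_sequence_mem_Hb hX hg)
  smul _ hf c := hL.smul _ (S.comp_sequence_mem_Hb hX hf) c

theorem bddLip_comp_mem_Hb {X : ℕ → Ω → ℝ} (hX : ∀ i, X i ∈ S.H) {d : ℕ} (s : Fin d → ℕ)
    {φ : (Fin d → ℝ) → ℝ} (hφ : BddLip φ) :
    (fun x : ℕ → ℝ => φ fun i => x (s i)) ∈ (S.ofSequence X hX).Hb := by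
  obtain ⟨M, hM⟩ := hφ.1
  exact ⟨comp_mem_cylinderFunctions d (fun i x => x (s i))
    (fun i => coord_mem_cylinderFunctions (s i)) φ hφ.locLip, M, fun x => hM _⟩

theorem lowerProb_le {P : ProbabilityMeasure Ω} (hP : P ∈ S.dominated) {A : Set Ω}
    (hA : MeasurableSet A) : S.lowerProb A ≤ (P : Measure Ω) A := by
  rw [lowerProb, tsub_le_iff_right]
  calc (1 : ℝ≥0∞) = (P : Measure Ω) A + (P : Measure Ω) Aᶜ := by
        rw [measure_add_measure_compl hA, measure_univ]
    _ ≤ _ := by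
      gcongr
      exact S.le_upperProb hP _

end SublinearExpectationSpace

end SubLin

theorem mainTheorem10 {Ω : Type*} [MeasurableSpace Ω]
    (S : SubLin.SublinearExpectationSpace Ω)
    (V : Set Ω → ℝ≥0∞) (hV : SubLin.IsCapacity V) (hSV : S.Sandwich V)
    (X : ℕ → Ω → ℝ) (hX : ∀ i, X i ∈ S.H) :
    ∃ (S' : SubLin.SublinearExpectationSpace (ℕ → ℝ)) (X' : ℕ → (ℕ → ℝ) → ℝ),
      -- the new space: cylinder functions and coordinates on `ℝ^∞`
      (S'.H : Set ((ℕ → ℝ) → ℝ)) = SubLin.cylinderFunctions ∧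
      (∀ i x, X' i x = x i) ∧ (∀ i, X' i ∈ S'.H) ∧
      S'.sigmaH = borel (ℕ → ℝ) ∧
      -- (a)
      (∀ (n : ℕ) (φ : (Fin n → ℝ) → ℝ), SubLin.LocLip φ →
        S'.E (fun x => φ (fun i => X' i x)) = S.E (fun ω => φ (fun i => X i ω))) ∧
      (S.IndepSeq X → S'.IndepSeq X') ∧
      -- (b)
      ((∀ A, MeasurableSet A → S'.upperProb A ≤ 1) ∧
        (∀ A B, MeasurableSet A → MeasurableSet B → A ⊆ B →
          S'.upperProb A ≤ S'.upperProb B) ∧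
        SubLin.CountablySubadditive S'.upperProb ∧
        (∀ A, MeasurableSet A → S'.upperProb A ≤ S'.cStar A ∧
          S'.cStar A ≤ S'.upCapStar A ∧ S'.upCapStar A ≤ S'.upCap A)) ∧
      -- (c)
      ((∀ i, SubLin.Tight V (X i)) →
        IsCompact S'.dominated ∧
        (∀ φ ∈ S'.Hb, S'.E φ =
          ⨆ P ∈ S'.dominated, ((∫ x, φ x ∂(P : Measure (ℕ → ℝ)) : ℝ) : EReal)) ∧
        SubLin.IsCapacity S'.upperProb ∧
        SubLin.CountablySubadditive S'.upperProb ∧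
        S'.Sandwich S'.upperProb) ∧
      -- (d)
      (S.IndepSeq X → (∀ i, SubLin.Tight V (X i)) →
        ∀ n : ℕ → ℕ, StrictMono n →
        ∀ E : ℕ → (Ω → ℝ) → ℝ,
          (∀ k, SubLin.IsLinearExpectationOn S.Hb (E k)) →
          (∀ k, ∀ f ∈ S.Hb, ((E k f : ℝ) : EReal) ≤ S.E f) →
          ∃ Q : ProbabilityMeasure (ℕ → ℝ),
            iIndepFun (fun (k : ℕ) (x : ℕ → ℝ) (i : Fin (n (k + 1) - n k)) =>
              X' (n k + i) x) (Q : Measure (ℕ → ℝ)) ∧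
            (∀ (k : ℕ) (φ : (Fin (n (k + 1) - n k) → ℝ) → ℝ), SubLin.BddLip φ →
              ∫ x, φ (fun i => X' (n k + i) x) ∂(Q : Measure (ℕ → ℝ)) =
                E k (fun ω => φ (fun i => X (n k + i) ω))) ∧
            (∀ (d : ℕ) (φ : (Fin d → ℝ) → ℝ), SubLin.BddLip φ →
              ((∫ x, φ (fun i => X' i x) ∂(Q : Measure (ℕ → ℝ)) : ℝ) : EReal) ≤
                S.E (fun ω => φ (fun i => X i ω))) ∧
            (∀ B : Set (ℕ → ℝ), MeasurableSet B →
              S'.lowerProb {x | (fun i => X' i x) ∈ B} ≤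
                  (Q : Measure (ℕ → ℝ)) {x | (fun i => X' i x) ∈ B} ∧
                (Q : Measure (ℕ → ℝ)) {x | (fun i => X' i x) ∈ B} ≤
                  S'.upperProb {x | (fun i => X' i x) ∈ B})) := by

  have hcoord : ∀ i, (fun x : ℕ → ℝ => x i) ∈ (S.ofSequence X hX).H :=
    SubLin.coord_mem_cylinderFunctions
  refine ⟨S.ofSequence X hX, fun i x => x i, rfl, fun _ _ => rfl, hcoord,
    SubLin.SublinearExpectationSpace.sigmaH_eq_borel _ rfl, fun _ _ _ => rfl,
    S.indepSeq_ofSequence hX, ?_, fun ht => ?_, fun hind ht n hn E hE hES => ?_⟩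
  · generalize S.ofSequence X hX = T
    exact ⟨fun A _ => T.upperProb_le_one A, fun _ _ _ _ h => T.upperProb_mono h,
      T.countablySubadditive_upperProb, fun A hA => ⟨T.upperProb_le_cStar hA,
        T.cStar_le_upCapStar A, T.upCapStar_le_upCap hA⟩⟩
  · have hT := S.isCoordTight_ofSequence hSV hX ht
    exact ⟨hT.isCompact_dominated, fun _ hφ => hT.E_eq_iSup hφ, hT.isCapacity_upperProb,
      SubLin.SublinearExpectationSpace.countablySubadditive_upperProb _, hT.sandwich_upperProb⟩
  · have hT := S.isCoordTight_ofSequence hSV hX ht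
    have hle : ∀ k, ∀ f ∈ (S.ofSequence X hX).Hb,
        E k (fun ω => f fun i => X i ω) ≤ (S.ofSequence X hX).e f := fun k f hf => by
      rw [← EReal.coe_le_coe_iff, (S.ofSequence X hX).coe_e hf]
      exact hES k _ (S.comp_sequence_mem_Hb hX hf)
    choose P hP using fun k =>
      hT.exists_probabilityMeasure (S.isLinearExpectationOn_ofSequence hX (hE k)) (hle k)
    have hPd : ∀ k, P k ∈ (S.ofSequence X hX).dominated := fun k =>
      (S.ofSequence X hX).mem_dominated_iff.2 fun f hf => (hP k f hf).trans_le (hle k f hf)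
    obtain ⟨Q, hQ, hQi, hQP⟩ :=
      hT.exists_mem_dominated_blocks (S.indepSeq_ofSequence hX hind) hn hPd
    refine ⟨Q, hQi, fun k φ hφ => ?_, fun d φ hφ => ?_, fun B hB => ⟨?_, ?_⟩⟩
    · rw [hQP k φ hφ.locLip.polyLip.continuous]
      exact hP k _ (S.bddLip_comp_mem_Hb hX (fun i => n k + i) hφ)
    · exact hQ _ (S.bddLip_comp_mem_Hb hX (fun i => i) hφ)
    · exact SubLin.SublinearExpectationSpace.lowerProb_le _ hQ hB
    · exact SubLin.SublinearExpectationSpace.le_upperProb _ hQ B
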